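/- **Setting.** Let $X,Y$ be (real or complex) Banach spaces, $A,B$ closed linear operators from $X$ to $Y$ with dense domains $D_A,D_B$, $\operatorname{range}(A)$ closed, $D:=D_A\subseteq D_B$, and let $f\in C(\mathbb R_+\times D,Y)$, $\mathbb R_+=[0,\infty)$ ($D$ carries the norm of $X$). Consider $$\tfrac{d}{dt}[Ax]+Bx=f(t,x),\quad t>0,\qquad x(t_0)=x_0. \tag{1}$$ A solution on an interval $J\subseteq\mathbb R_+$ is $x\in C(J,X)$ with $x(t)\in D$ for $t\in J$, $Ax$ continuously differentiable on $J\cap(0,\infty)$, and (1) satisfied there. Let $\lambda A+B$ be a regular pencil of index $\nu$: $(\lambda A+B)^{-1}\in\mathcal L(Y,X)$ exists for all complex $\lambda$ with $|\lambda|$ large, and $\nu\in\{0,1,2,\dots\}$ is the least number with $\|(\lambda A+B)^{-1}\|\le C|\lambda|^{\nu-1}$ for large $|\lambda|$ (complexifying if the spaces are real). Let $\dim\ker A=n<\infty$, and let $\varphi_i^j\in D$, $q_i^j\in Y^*$ ($1\le i\le n$, $1\le j\le m_i$, $\max_i m_i=\nu$) be a canonical system of root vectors: $\varphi_1^1,\dots,\varphi_n^1$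 is a basis of $\ker A$, $A\varphi_i^j=-B\varphi_i^{j-1}$ for $j\ge2$, and on $D$: $q_i^{m_i}\circ A=0$, $q_i^j\circ A=-q_i^{j+1}\circ B$ for $j<m_i$, and $q_k^l(B\varphi_i^j)=\delta_{ik}\delta_{jl}$. For $x\in D$, $y\in Y$ put $$P_{20}x=\sum_i q_i^1(Bx)\varphi_i^1,\quad P_{2\Sigma}x=\sum_i\sum_{j=2}^{m_i}q_i^j(Bx)\varphi_i^j,\quad P_1=I-P_{20}-P_{2\Sigma},$$ $$Q_{2*}y=\sum_i q_i^{m_i}(y)B\varphi_i^{m_i},\quad Q_{2\Sigma}y=\sum_i\sum_{j=1}^{m_i-1}q_i^j(y)B\varphi_i^j,\quad Q_1=I-Q_{2*}-Q_{2\Sigma},$$ and let $D_1,D_{2\Sigma},D_{20}=\ker A$ and $Y_1,Y_{2\Sigma},Y_{2*}$ be the corresponding ranges, $x_1=P_1x$, $x_{2\Sigma}=P_{2\Sigma}x$, $x_{20}=P_{20}x$, $W=Y_1\dot+Y_{2\Sigma}$, $$\widetilde A=A+\sum_i q_i^1(B\,\cdot)\,B\varphi_i^{m_i}:D\to Y,\qquad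 \Pi(t,x)=\widetilde A^{-1}(Q_1+Q_{2\Sigma})[f(t,x)-Bx],$$ $$L_0=\{(t,x)\in\mathbb R_+\times D: Q_{2*}[f(t,x)-Bx]=0\},\qquad F_{2*}(t,x_1,x_{2\Sigma},x_{20})=Q_{2*}f(t,x_1+x_{2\Sigma}+x_{20})-Q_{2*}B(x_{20}+x_{2\Sigma}).$$ **Theorem (Global solvability).** Assume: 1. For all $t\in\mathbb R_+$ and $x_1+x_{2\Sigma}\in D_1\dot+D_{2\Sigma}$ there is a unique $x_{20}\in D_{20}$ with $(t,x_1+x_{2\Sigma}+x_{20})\in L_0$. 2. There are operators $W_{t',x'}\in\mathcal L(D_{20},Y_{2*})$ with inverses $W_{t',x'}^{-1}\in\mathcal L(Y_{2*},D_{20})$, $(t',x')\in L_0$, such that one of the following holds. (a) $f$ is locally Lipschitz in $x$ on $\mathbb R_+\times D$, and for each $(t',x')\in L_0$ and all sufficiently small $\delta,\varepsilon>0$, $$\|F_{2*}(t,x_1,x_{2\Sigma},y)-F_{2*}(t,x_1,x_{2\Sigma},z)-W_{t',x'}[y-z]\|\le \kappa(\delta,\varepsilon)\|y-z\|$$ for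 all $t\in\mathbb R_+$, $x_1\in D_1$, $x_{2\Sigma}\in D_{2\Sigma}$ at distance less than $\delta$ from $t',x_1',x_{2\Sigma}'$ and all $y,z\in D_{20}$ at distance less than $\varepsilon$ from $x_{20}'$, where $\lim_{\delta,\varepsilon\to0}\kappa(\delta,\varepsilon)$ exists and is $<\|W_{t',x'}^{-1}\|^{-1}$. (b) $f$ has a continuous Fréchet partial derivative $\partial_xf$ on $\mathbb R_+\times D$, and $W_{t',x'}=[Q_{2*}\partial_xf(t',x')-Q_{2*}B]\big|_{D_{20}}$ for each $(t',x')\in L_0$. 3. For all $a_1,a_2>0$ there is a $K>0$ such that $$\sup\{\|x_{20}-W_{t,x}^{-1}F_{2*}(t,x_1,x_{2\Sigma},x_{20})\|:(t,x)\in L_0,\ t\in[0,a_1],\ \|x_1+x_{2\Sigma}\|\le a_2\}\le K,$$ $$\sup\{\|(Q_1+Q_{2\Sigma})f(t,x)\|:(t,x)\in L_0,\ t\in[0,a_1],\ \|x_1+x_{2\Sigma}\|\le a_2,\ \|x_{20}\|\le K\}<\infty.$$ 4. There are $R>0$, a functional $V=\max_{1\le i\le N}V_i$ on $W$, where $V_i\in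 C(W,\mathbb R_+)$ are continuously differentiable (over $\mathbb R$) on $\{w\in W:\|w\|\ge R\}$, a function $U\in C(\mathbb R_+,\mathbb R_+)$ and a function $\psi:\mathbb R_+\to\mathbb R_+$ integrable on each finite interval, such that $\int_{u_0}^\infty\frac{du}{U(u)}=\infty$ for every $u_0>0$ (with $1/0=\infty$), $V(w)\to\infty$ as $\|w\|\to\infty$, and for every $w\in W$ with $\|w\|\ge R$ and every $(t,\widetilde A^{-1}w+x_{20})\in L_0$ with $x_{20}\in D_{20}$, $$\big\langle\widetilde A\,\Pi(t,\widetilde A^{-1}w+x_{20}),\,\partial_wV_{j(w)}(w)\big\rangle\le U(V(w))\,\psi(t),$$ where $j(w)$ is an index chosen with $V(w)=V_{j(w)}(w)$. Then for every $(t_0,x_0)\in L_0$ problem (1) has a global solution on $[t_0,\infty)$. It is unique: every solution of (1) with $x(t_0)=x_0$ on an interval $J\subseteq[t_0,\infty)$ containing $t_0$ coincides with it on $J$. -/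

import Mathlib

open Set Filter Topology MeasureTheory

noncomputable section

namespace ADAE

/-! ### Index of an operator pencil -/

/-- `T lam : E → F` plays the role of `lam A + B`, with `lam` in a copy `K` of the complex numbers.
The pencil is regular for all large `|lam|` (the operator is a bijection onto `F` with bounded
inverse `R(lam)`), and `ν` is the least natural number such that, for some constants `C, R > 0`,
`‖R(lam)‖ ≤ C |lam| ^ (ν - 1)` whenever `|lam| ≥ R`; equivalently
`‖(A + μ B)⁻¹‖ ≤ C / |μ| ^ ν` for `0 < |μ| ≤ 1 / R`, i.e. the resolvent `(A + μ B)⁻¹` has a pole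
of order `ν` at `μ = 0` (`ν = 0`: the operator `A` has a bounded inverse). -/
def HasPencilIndex {K E F : Type*} [Norm K] [Norm E] [Norm F] (T : K → E → F) (ν : ℕ) : Prop :=
  (∃ R : ℝ, 0 < R ∧ ∀ lam : K, R < ‖lam‖ →
      Function.Bijective (T lam) ∧ ∃ C : ℝ, ∀ x : E, ‖x‖ ≤ C * ‖T lam x‖) ∧
  IsLeast {k : ℕ | ∃ C : ℝ, 0 < C ∧ ∃ R : ℝ, 0 < R ∧ ∀ lam : K, R ≤ ‖lam‖ →
      ∀ x : E, ‖x‖ ≤ C * ‖lam‖ ^ ((k : ℤ) - 1) * ‖T lam x‖} ν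

section Pencil

variable {𝕜 D Y : Type*} [RCLike 𝕜] [NormedAddCommGroup D] [NormedSpace 𝕜 D]
  [NormedAddCommGroup Y] [NormedSpace 𝕜 Y]

/-- The operator pencil `lam A + B`. -/
def pencil (A B : D →ₗ[𝕜] Y) (lam : 𝕜) (x : D) : Y := lam • A x + B x

/-- The pencil `z Ã + B̃` of the complex extensions of `A` and `B`, for `z ∈ ℂ`, where the pair
`(u, v)` stands for the element `u + i v` of the complexification. -/
def complexifiedPencil (A B : D →ₗ[𝕜] Y) (z : ℂ) (x : D × D) : Y × Y :=
  ((z.re : 𝕜) • A x.1 - (z.im : 𝕜) • A x.2 + B x.1,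
   (z.im : 𝕜) • A x.1 + (z.re : 𝕜) • A x.2 + B x.2)

/-- `lam A + B` is a regular pencil of index `ν`. Over the complex field (`RCLike.I ≠ 0`) this is
the condition on the pencil itself; over the real field (`RCLike.I = 0`) it is the condition on
the complexified pencil. (The index does not depend on which of the equivalent norms is used on
the complexification.) -/
def IsRegularPencilOfIndex (A B : D →ₗ[𝕜] Y) (ν : ℕ) : Prop :=
  ((RCLike.I : 𝕜) ≠ 0 → HasPencilIndex (pencil A B) ν) ∧
  ((RCLike.I : 𝕜) = 0 → HasPencilIndex (complexifiedPencil A B) ν)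

/-! ### Canonical systems of root vectors and the associated projectors -/

/-- A canonical system `φ i j` (`1 ≤ j ≤ m i`) of eigenvectors and adjoined vectors of the pencil
`A + μ B` at `μ = 0`, together with the biorthogonal functionals `q i j`. The indices `j` start
from `1`; values of `φ i j`, `q i j` for other `j` are never used. The relations
`A* q_i^{m_i} = 0` and `A* q_i^j = - B* q_i^{j+1}` are written out on the common domain `D`. -/
structure CanonicalSystem (A B : D →ₗ[𝕜] Y) (ν n : ℕ) where
  m : Fin n → ℕ
  φ : Fin n → ℕ → D
  q : Fin n → ℕ → (Y →L[𝕜] 𝕜)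
  one_le_m : ∀ i, 1 ≤ m i
  max_m : Finset.univ.sup m = ν
  linearIndependent_eigenvectors : LinearIndependent 𝕜 (fun i => φ i 1)
  span_eigenvectors : Submodule.span 𝕜 (Set.range fun i => φ i 1) = LinearMap.ker A
  map_adjoined : ∀ i, ∀ j ∈ Finset.Icc 2 (m i), A (φ i j) = -B (φ i (j - 1))
  adjoint_last : ∀ i, ∀ x : D, q i (m i) (A x) = 0
  adjoint_chain : ∀ i, ∀ j ∈ Finset.Icc 1 (m i - 1), ∀ x : D, q i j (A x) = -q i (j + 1) (B x)
  biorthogonal : ∀ i, ∀ j ∈ Finset.Icc 1 (m i), ∀ k, ∀ l ∈ Finset.Icc 1 (m k),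
    q k l (B (φ i j)) = if i = k ∧ j = l then 1 else 0

namespace CanonicalSystem

variable {A B : D →ₗ[𝕜] Y} {ν n : ℕ} (S : CanonicalSystem A B ν n)

/-- The rank-one operator `⟨·, B* q_i^j⟩ φ_i^j` on `D`. -/
def rankOneD (i : Fin n) (j : ℕ) : D →ₗ[𝕜] D :=
  ((S.q i j).toLinearMap ∘ₗ B).smulRight (S.φ i j)

/-- The rank-one operator `⟨·, q_i^j⟩ B φ_i^j` on `Y`. -/
def rankOneY (i : Fin n) (j : ℕ) : Y →L[𝕜] Y := (S.q i j).smulRight (B (S.φ i j))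

def P2 : D →ₗ[𝕜] D := ∑ i, ∑ j ∈ Finset.Icc 1 (S.m i), S.rankOneD i j

def P1 : D →ₗ[𝕜] D := LinearMap.id - S.P2

def P20 : D →ₗ[𝕜] D := ∑ i, S.rankOneD i 1

def P2Sigma : D →ₗ[𝕜] D := ∑ i, ∑ j ∈ Finset.Icc 2 (S.m i), S.rankOneD i j

def Q2 : Y →L[𝕜] Y := ∑ i, ∑ j ∈ Finset.Icc 1 (S.m i), S.rankOneY i j

def Q1 : Y →L[𝕜] Y := ContinuousLinearMap.id 𝕜 Y - S.Q2

def Q2star : Y →L[𝕜] Y := ∑ i, S.rankOneY i (S.m i)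

def Q2Sigma : Y →L[𝕜] Y := ∑ i, ∑ j ∈ Finset.Icc 1 (S.m i - 1), S.rankOneY i j

def D1 : Submodule 𝕜 D := LinearMap.range S.P1

/-- `D₂₀ = ker A`. -/
def D20 (_S : CanonicalSystem A B ν n) : Submodule 𝕜 D := LinearMap.ker A

def D2Sigma : Submodule 𝕜 D :=
  Submodule.span 𝕜 {x | ∃ i, ∃ j ∈ Finset.Icc 2 (S.m i), x = S.φ i j}

def Y1 : Submodule 𝕜 Y := LinearMap.range S.Q1.toLinearMap

def Y2star : Submodule 𝕜 Y := Submodule.span 𝕜 (Set.range fun i => B (S.φ i (S.m i)))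

def Y2Sigma : Submodule 𝕜 Y :=
  Submodule.span 𝕜 {y | ∃ i, ∃ j ∈ Finset.Icc 1 (S.m i - 1), y = B (S.φ i j)}

/-- `W = Y₁ ∔ Y₂Σ`. -/
def W : Submodule 𝕜 Y := S.Y1 ⊔ S.Y2Sigma

/-- `Ã = A + ∑ i, ⟨·, B* q_i^1⟩ B φ_i^{m_i}`. -/
def Atilde : D →ₗ[𝕜] Y :=
  A + ∑ i, ((S.q i 1).toLinearMap ∘ₗ B).smulRight (B (S.φ i (S.m i)))

/-- The inverse of `Ã : D → Y` (`Ã` is a bijection when `lam A + B` is a regular pencil of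
index `ν`). -/
def AtildeInv : Y → D := Function.invFun S.Atilde

theorem Q2star_mem (y : Y) : S.Q2star y ∈ S.Y2star := by
  unfold Q2star Y2star rankOneY
  rw [_root_.sum_apply]
  exact Submodule.sum_mem _ fun i _ =>
    Submodule.smul_mem _ _ (Submodule.subset_span ⟨i, rfl⟩)

/-! ### The reduced system -/

/-- The manifold `L₀` of consistent points. -/
def L0 (f : ℝ → D → Y) : Set (ℝ × D) :=
  {p | 0 ≤ p.1 ∧ S.Q2star (f p.1 p.2 - B p.2) = 0}

/-- `F₂*(t, x₁, x₂Σ, x₂₀) = Q₂* f(t, x₁ + x₂Σ + x₂₀) - Q₂* B (x₂₀ + x₂Σ)`, with values in `Y₂*`. -/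
def F2star (f : ℝ → D → Y) (t : ℝ) (x1 x2S x20 : D) : S.Y2star :=
  ⟨S.Q2star (f t (x1 + x2S + x20)) - S.Q2star (B (x20 + x2S)),
    S.Y2star.sub_mem (S.Q2star_mem _) (S.Q2star_mem _)⟩

/-- `Π(t, x) = Ã⁻¹ (Q₁ + Q₂Σ) [f(t, x) - B x]`. -/
def drift (f : ℝ → D → Y) (t : ℝ) (x : D) : D :=
  S.AtildeInv (S.Q1 (f t x - B x) + S.Q2Sigma (f t x - B x))

/-! ### The hypotheses -/

/-- For all `t ≥ 0` and `u = x₁ + x₂Σ ∈ D₁ ∔ D₂Σ` there is a unique `x₂₀ ∈ D₂₀` with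
`(t, u + x₂₀) ∈ L₀`. -/
def UniqueAlgebraicPart (f : ℝ → D → Y) : Prop :=
  ∀ t : ℝ, 0 ≤ t → ∀ u ∈ S.D1 ⊔ S.D2Sigma, ∃! x20 : D, x20 ∈ S.D20 ∧ (t, u + x20) ∈ S.L0 f

/-- `f` is locally Lipschitz in `x` on `ℝ₊ × D`, and near each `(t', x') ∈ L₀` the mapping `F₂*`
is approximated in `x₂₀` by the isomorphism `Wop t' x'` up to a factor `κ(δ, ε)` whose limit `ℓ` as
`δ, ε → 0` satisfies `ℓ < ‖(Wop t' x')⁻¹‖⁻¹` (written as `ℓ ‖(Wop t' x')⁻¹‖ < 1`, which also covers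
`D₂₀ = 0`). -/
def LipschitzCondition (f : ℝ → D → Y) (Wop : ℝ → D → (S.D20 ≃L[𝕜] S.Y2star)) : Prop :=
  (∀ t' : ℝ, 0 ≤ t' → ∀ x' : D, ∃ r : ℝ, 0 < r ∧ ∃ L : ℝ, 0 ≤ L ∧
    ∀ t : ℝ, 0 ≤ t → |t - t'| < r → ∀ x y : D, ‖x - x'‖ < r → ‖y - x'‖ < r →
      ‖f t x - f t y‖ ≤ L * ‖x - y‖) ∧
  ∀ t' : ℝ, ∀ x' : D, (t', x') ∈ S.L0 f →
    ∃ δ₀ : ℝ, 0 < δ₀ ∧ ∃ ε₀ : ℝ, 0 < ε₀ ∧ ∃ κ : ℝ → ℝ → ℝ, ∃ ℓ : ℝ,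
      Tendsto (fun p : ℝ × ℝ => κ p.1 p.2) (𝓝[>] 0 ×ˢ 𝓝[>] 0) (𝓝 ℓ) ∧
      ℓ * ‖((Wop t' x').symm : S.Y2star →L[𝕜] S.D20)‖ < 1 ∧
      ∀ δ ∈ Set.Ioc 0 δ₀, ∀ ε ∈ Set.Ioc 0 ε₀,
        ∀ t : ℝ, 0 ≤ t → |t - t'| < δ →
        ∀ x1 ∈ S.D1, ‖x1 - S.P1 x'‖ < δ →
        ∀ x2S ∈ S.D2Sigma, ‖x2S - S.P2Sigma x'‖ < δ →
        ∀ y z : S.D20, ‖(y : D) - S.P20 x'‖ < ε → ‖(z : D) - S.P20 x'‖ < ε →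
          ‖S.F2star f t x1 x2S y - S.F2star f t x1 x2S z - Wop t' x' (y - z)‖ ≤
            κ δ ε * ‖y - z‖

/-- `f` has a continuous Fréchet partial derivative in `x` on `ℝ₊ × D`, and at each
`(t', x') ∈ L₀` the operator `∂F₂*/∂x₂₀ = [∂ₓ(Q₂* f)(t', x') - Q₂* B]` from `D₂₀` to `Y₂*` is
the isomorphism `Wop t' x'`. -/
def SmoothCondition (f : ℝ → D → Y) (Wop : ℝ → D → (S.D20 ≃L[𝕜] S.Y2star)) : Prop :=
  ∃ f' : ℝ → D → (D →L[𝕜] Y),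
    (∀ t : ℝ, 0 ≤ t → ∀ x : D, HasFDerivAt (f t) (f' t x) x) ∧
    ContinuousOn (fun p : ℝ × D => f' p.1 p.2) (Set.Ici 0 ×ˢ Set.univ) ∧
    ∀ t' : ℝ, ∀ x' : D, (t', x') ∈ S.L0 f → ∀ d : S.D20,
      (Wop t' x' d : Y) = S.Q2star (f' t' x' d) - S.Q2star (B d)

/-- Boundedness of `x₂₀ - W_{t,x}⁻¹ F₂*` and of `(Q₁ + Q₂Σ) f` on the parts of `L₀` where
`t ∈ [0, a₁]` and `‖x₁ + x₂Σ‖ ≤ a₂`. -/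
def BoundednessCondition (f : ℝ → D → Y) (Wop : ℝ → D → (S.D20 ≃L[𝕜] S.Y2star)) : Prop :=
  ∀ a₁ a₂ : ℝ, 0 < a₁ → 0 < a₂ → ∃ K : ℝ, 0 < K ∧
    (∀ t : ℝ, ∀ x : D, (t, x) ∈ S.L0 f → t ≤ a₁ → ‖S.P1 x + S.P2Sigma x‖ ≤ a₂ →
      ‖S.P20 x - (((Wop t x).symm (S.F2star f t (S.P1 x) (S.P2Sigma x) (S.P20 x)) : S.D20) : D)‖
        ≤ K) ∧
    ∃ C : ℝ, ∀ t : ℝ, ∀ x : D, (t, x) ∈ S.L0 f → t ≤ a₁ → ‖S.P1 x + S.P2Sigma x‖ ≤ a₂ →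
      ‖S.P20 x‖ ≤ K → ‖S.Q1 (f t x) + S.Q2Sigma (f t x)‖ ≤ C

/-- The Lyapunov-type condition with `V(w) = max_i V_i(w)`; `j w` is an index at which the maximum
is attained. The pairing with the gradient of `V_j` is the (real) Fréchet derivative of `V_j`
relative to `{‖w‖ ≥ R}`; `v` is the vector `Ã Π(t, x)`, viewed as an element of `W`. -/
structure LyapunovCondition [NormedSpace ℝ Y] [IsScalarTower ℝ 𝕜 Y] (f : ℝ → D → Y)
    {N : ℕ} (R : ℝ) (V : Fin N → S.W → ℝ) (j : S.W → Fin N) (U ψ : ℝ → ℝ) : Prop where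
  R_pos : 0 < R
  V_continuous : ∀ i, Continuous (V i)
  V_nonneg : ∀ i w, 0 ≤ V i w
  V_contDiffOn : ∀ i, ContDiffOn ℝ 1 (V i) {w : S.W | R ≤ ‖w‖}
  j_max : ∀ w i, V i w ≤ V (j w) w
  U_continuousOn : ContinuousOn U (Set.Ici 0)
  U_nonneg : ∀ u, 0 ≤ u → 0 ≤ U u
  ψ_nonneg : ∀ t, 0 ≤ t → 0 ≤ ψ t
  ψ_integrableOn : ∀ T : ℝ, 0 ≤ T → IntegrableOn ψ (Set.Icc 0 T)
  integral_inv_U : ∀ u₀ : ℝ, 0 < u₀ → ∫⁻ u in Set.Ioi u₀, (ENNReal.ofReal (U u))⁻¹ = ⊤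
  V_tendsto : Tendsto (fun w => ⨆ i, V i w) (Bornology.cobounded S.W) atTop
  inequality : ∀ t : ℝ, ∀ w : S.W, ∀ x20 ∈ S.D20,
    (t, S.AtildeInv w + x20) ∈ S.L0 f → R ≤ ‖w‖ →
    ∀ v : S.W, (v : Y) = S.Atilde (S.drift f t (S.AtildeInv w + x20)) →
      fderivWithin ℝ (V (j w)) {w : S.W | R ≤ ‖w‖} w v ≤ U (⨆ i, V i w) * ψ t

end CanonicalSystem

/-- `x` is a solution of `d/dt [A x] + B x = f(t, x)`, `t > 0`, on the interval `J ⊆ ℝ₊`: `x` is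
continuous on `J` (in the norm of `X`, which is the norm of `D`), takes values in `D`, `A x` is
continuously differentiable, and the equation holds. -/
structure IsSolutionOn [NormedSpace ℝ Y] (A B : D →ₗ[𝕜] Y) (f : ℝ → D → Y) (J : Set ℝ)
    (x : ℝ → D) : Prop where
  continuousOn : ContinuousOn x J
  contDiffOn : ContDiffOn ℝ 1 (fun t => A (x t)) (J ∩ Set.Ioi 0)
  equation : ∀ t ∈ J, 0 < t → derivWithin (fun s => A (x s)) J t + B (x t) = f t (x t)

end Pencil

/-- The restriction of the operator `B` to `D = D_A ⊆ D_B`. -/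
def restrictTo {𝕜 X Y : Type*} [RCLike 𝕜] [NormedAddCommGroup X] [NormedSpace 𝕜 X]
    [NormedAddCommGroup Y] [NormedSpace 𝕜 Y] (B : X →ₗ.[𝕜] Y) (D : Submodule 𝕜 X)
    (h : D ≤ B.domain) : D →ₗ[𝕜] Y :=
  B.toFun ∘ₗ Submodule.inclusion h

end ADAE

end

/-!
The operator `Ã` is an isomorphism of `D`, with the graph norm of `A`, onto `Y`. It is injective
by the biorthogonality relations, and its range is closed because that of `A` is; hence it is
bounded below. It differs by an operator of finite rank from `A`, and `A + μ B` is an isomorphism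
for arbitrarily small `μ`, so `Ã + μ B` has index zero and is onto, and the uniform lower bound
passes this on to `Ã` (`surjective_of_finite_rank_perturbation`, `CanonicalSystem.isTame`). The
operators `Ã⁻¹` and `B Ã⁻¹` are bounded, `B` is bounded relative to `A`, and `W` is the kernel
of `Q₂*`.

Every `x ∈ D` is the sum of `Ã⁻¹ w`, with `w = A x ∈ W`, and of `x₂₀ ∈ ker A`. On `L₀` the part
`x₂₀ = η(t, w)` is a function of `t` and `w` by unique solvability. Near a consistent point both
versions of the local condition make `x₂₀ ↦ x₂₀ - Λ⁻¹ F₂*` a contraction, so `η` is continuous and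
locally Lipschitz in `w` (`continuous_of_unique_zero`, `isLocallyLipschitz_of_unique_zero`). The
problem is thereby equivalent to the ordinary differential equation
`w' = (I - Q₂*)[f(t, x) - B x]`, `x = Ã⁻¹ w + η(t, w)`, in the Banach space `W` (`CanonicalSystem.field`).

Since `F₂*` vanishes on `L₀`, the boundedness condition bounds `η`, and with it the right-hand
side, on bounded sets (`CanonicalSystem.exists_bound_field`). A solution that cannot be continued
beyond a time `T` then satisfies `‖w‖ → ∞`, and in particular it remains in `{‖w‖ > R}` near `T`.
There the function `m(t) = max_i V_i(w(t))` is locally Lipschitz, and wherever it is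
differentiable its derivative is that of any `V_i(w(t))` at which the maximum is attained; so the
Lyapunov inequality at the chosen index gives `m' ≤ U(m) ψ` almost everywhere, and integration
yields `∫ du / U(u) ≤ ∫ ψ`, which is incompatible with `m → ∞` (`not_tendsto_max_atTop`).

For uniqueness, a solution `y` takes values in `L₀`, so `A y` solves the reduced equation. The
only delicate point is the continuity of `A y` at the initial time `0`: as `(A y)'` grows at most
linearly with `A y`, the limit at `0` exists, and it is `A y(0)` because `A` is closed
(`CanonicalSystem.isRightSolution_A`).
-/

noncomputable section

namespace ADAE

/-! ### Identities for the projectors of a canonical system -/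

namespace CanonicalSystem

variable {𝕜 D Y : Type*} [RCLike 𝕜] [NormedAddCommGroup D] [NormedSpace 𝕜 D]
  [NormedAddCommGroup Y] [NormedSpace 𝕜 Y] {A B : D →ₗ[𝕜] Y} {ν n : ℕ}
  (S : CanonicalSystem A B ν n)

/-- Biorthogonality: the functionals `⟨B ·, q_i^l⟩` read off the coefficients of a combination of
root vectors `φ_k^j`, `j ∈ s k`. -/
theorem q_B_sum (s : Fin n → Finset ℕ) (hs : ∀ k, s k ⊆ Finset.Icc 1 (S.m k))
    (c : Fin n → ℕ → 𝕜) (i : Fin n) {l : ℕ} (hl : l ∈ Finset.Icc 1 (S.m i)) :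
    S.q i l (B (∑ k, ∑ j ∈ s k, c k j • S.φ k j)) = if l ∈ s i then c i l else 0 := by
  have h1 : ∀ k, ∀ j ∈ s k, S.q i l (B (c k j • S.φ k j)) =
      if k = i ∧ j = l then c k j else 0 := by
    intro k j hj
    rw [map_smul, map_smul, S.biorthogonal k j (hs k hj) i l hl, smul_eq_mul]
    split_ifs <;> simp
  simp only [map_sum]
  rw [Finset.sum_congr rfl fun k _ => Finset.sum_congr rfl (h1 k)]
  rw [Finset.sum_eq_single i]
  · simp
  · intro k _ hk
    simp [hk]
  · simp

theorem one_mem (i : Fin n) : 1 ∈ Finset.Icc 1 (S.m i) := by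
  simpa using S.one_le_m i

theorem last_mem (i : Fin n) : S.m i ∈ Finset.Icc 1 (S.m i) := by
  simpa using S.one_le_m i

theorem P20_apply (x : D) :
    S.P20 x = ∑ k, ∑ j ∈ ({1} : Finset ℕ), S.q k j (B x) • S.φ k j := by
  simp [P20, rankOneD]

theorem P2Sigma_apply (x : D) :
    S.P2Sigma x = ∑ k, ∑ j ∈ Finset.Icc 2 (S.m k), S.q k j (B x) • S.φ k j := by
  simp [P2Sigma, rankOneD]

theorem P2_apply (x : D) :
    S.P2 x = ∑ k, ∑ j ∈ Finset.Icc 1 (S.m k), S.q k j (B x) • S.φ k j := by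
  simp [P2, rankOneD]

theorem P2_eq (x : D) : S.P2 x = S.P20 x + S.P2Sigma x := by
  rw [P2_apply, P20_apply, P2Sigma_apply, ← Finset.sum_add_distrib]
  refine Finset.sum_congr rfl fun k _ => ?_
  rw [Finset.sum_singleton, ← Finset.add_sum_Ioc_eq_sum_Icc (S.one_le_m k)]
  rfl

theorem P1_apply (x : D) : S.P1 x = x - S.P20 x - S.P2Sigma x := by
  rw [P1, LinearMap.sub_apply, LinearMap.id_apply, P2_eq]
  abel

theorem Q2_eq (y : Y) : S.Q2 y = S.Q2star y + S.Q2Sigma y := by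
  simp only [Q2, Q2star, Q2Sigma, _root_.sum_apply]
  rw [← Finset.sum_add_distrib]
  refine Finset.sum_congr rfl fun k _ => ?_
  obtain ⟨m, hm⟩ : ∃ m, S.m k = m + 1 := ⟨S.m k - 1, by have := S.one_le_m k; omega⟩
  rw [hm, Finset.sum_Icc_succ_top (by omega), add_comm]
  rfl

/-- `Q₁ + Q₂Σ = I - Q₂*`. -/
theorem Q1_add_Q2Sigma (y : Y) : S.Q1 y + S.Q2Sigma y = y - S.Q2star y := by
  rw [Q1, _root_.sub_apply, ContinuousLinearMap.id_apply, Q2_eq]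
  abel

theorem Q2star_apply (y : Y) :
    S.Q2star y = B (∑ k, ∑ j ∈ ({S.m k} : Finset ℕ), S.q k j y • S.φ k j) := by
  simp [Q2star, rankOneY]

theorem Q2Sigma_apply (y : Y) :
    S.Q2Sigma y = B (∑ k, ∑ j ∈ Finset.Icc 1 (S.m k - 1), S.q k j y • S.φ k j) := by
  simp [Q2Sigma, rankOneY]

theorem q_last_Q2star (i : Fin n) (y : Y) : S.q i (S.m i) (S.Q2star y) = S.q i (S.m i) y := by
  rw [Q2star_apply, S.q_B_sum _ (fun k => by simpa using S.one_le_m k) _ i (S.last_mem i)]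
  simp

theorem q_last_Q2Sigma (i : Fin n) (y : Y) : S.q i (S.m i) (S.Q2Sigma y) = 0 := by
  rw [Q2Sigma_apply, S.q_B_sum _ (fun k => Finset.Icc_subset_Icc_right (Nat.sub_le _ _)) _ i
    (S.last_mem i)]
  have := S.one_le_m i
  rw [if_neg]
  simp only [Finset.mem_Icc, not_and, not_le]
  omega

theorem Q2star_eq_zero_iff (y : Y) : S.Q2star y = 0 ↔ ∀ i, S.q i (S.m i) y = 0 := by
  constructor
  · intro h i
    rw [← q_last_Q2star, h, map_zero]
  · intro h
    simp [Q2star, rankOneY, h]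

theorem Q2star_A (x : D) : S.Q2star (A x) = 0 :=
  (S.Q2star_eq_zero_iff _).2 fun i => S.adjoint_last i x

theorem Q2star_sub_Q2star (y : Y) : S.Q2star (y - S.Q2star y) = 0 :=
  (S.Q2star_eq_zero_iff _).2 fun i => by rw [map_sub, q_last_Q2star, sub_self]

/-- `W` is the kernel of `Q₂*`. -/
theorem mem_W_iff (y : Y) : y ∈ S.W ↔ S.Q2star y = 0 := by
  constructor
  · suffices h : S.W ≤ LinearMap.ker S.Q2star.toLinearMap from fun hy => h hy
    refine sup_le ?_ ?_
    · rintro _ ⟨y, rfl⟩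
      change S.Q2star (S.Q1 y) = 0
      have h : S.Q1 y = (y - S.Q2star y) - S.Q2Sigma y := by
        rw [← Q1_add_Q2Sigma]; abel
      rw [h, Q2star_eq_zero_iff]
      intro i
      rw [map_sub, map_sub, q_last_Q2star, q_last_Q2Sigma]
      simp
    · refine Submodule.span_le.2 ?_
      rintro _ ⟨i, j, hj, rfl⟩
      change S.Q2star (B (S.φ i j)) = 0
      rw [Q2star_eq_zero_iff]
      intro k
      rw [Finset.mem_Icc] at hj
      rw [S.biorthogonal i j (Finset.mem_Icc.2 ⟨hj.1, by omega⟩) k _ (S.last_mem k), if_neg]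
      rintro ⟨rfl, h⟩
      omega
  · intro h
    have h2 : y = S.Q1 y + S.Q2Sigma y := by rw [Q1_add_Q2Sigma, h, sub_zero]
    rw [h2]
    refine Submodule.add_mem_sup ⟨y, rfl⟩ ?_
    simp only [Q2Sigma, _root_.sum_apply]
    exact Submodule.sum_mem _ fun i _ => Submodule.sum_mem _ fun j hj =>
      Submodule.smul_mem _ _ (Submodule.subset_span ⟨i, j, hj, rfl⟩)

theorem sub_Q2star_mem_W (y : Y) : y - S.Q2star y ∈ S.W :=
  (S.mem_W_iff _).2 (S.Q2star_sub_Q2star y)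

theorem A_mem_W (x : D) : A x ∈ S.W := (S.mem_W_iff _).2 (S.Q2star_A x)

theorem A_φ_one (i : Fin n) : A (S.φ i 1) = 0 := by
  have : S.φ i 1 ∈ LinearMap.ker A := by
    rw [← S.span_eigenvectors]
    exact Submodule.subset_span ⟨i, rfl⟩
  exact this

theorem A_P20 (x : D) : A (S.P20 x) = 0 := by
  simp [P20, rankOneD, A_φ_one]

theorem P20_mem (x : D) : S.P20 x ∈ S.D20 := S.A_P20 x

theorem q_B_P20 (i : Fin n) (x : D) : S.q i 1 (B (S.P20 x)) = S.q i 1 (B x) := by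
  rw [P20_apply, S.q_B_sum _ (fun k => by simpa using S.one_le_m k) _ i (S.one_mem i)]
  simp

/-- The elements of `D₂₀ = ker A` are the combinations of the eigenvectors `φ_k^1`, here written as
double sums over the pairs `(k, 1)`. -/
theorem exists_coord {x : D} (hx : x ∈ S.D20) :
    ∃ c : Fin n → 𝕜, x = ∑ k, ∑ j ∈ ({1} : Finset ℕ), c k • S.φ k j := by
  have hx' : x ∈ LinearMap.ker A := hx
  rw [← S.span_eigenvectors, Submodule.mem_span_range_iff_exists_fun] at hx'
  obtain ⟨c, hc⟩ := hx'
  exact ⟨c, by simp [hc]⟩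

theorem P20_of_mem {x : D} (hx : x ∈ S.D20) : S.P20 x = x := by
  obtain ⟨c, hc⟩ := S.exists_coord hx
  rw [P20_apply]
  conv_rhs => rw [hc]
  refine Finset.sum_congr rfl fun k _ => ?_
  rw [Finset.sum_singleton, Finset.sum_singleton, hc, S.q_B_sum _
    (fun k => by simpa using S.one_le_m k) (fun k _ => c k) k (S.one_mem k)]
  simp

theorem P2Sigma_of_mem {x : D} (hx : x ∈ S.D20) : S.P2Sigma x = 0 := by
  obtain ⟨c, hc⟩ := S.exists_coord hx
  rw [P2Sigma_apply]
  refine Finset.sum_eq_zero fun k _ => Finset.sum_eq_zero fun j hj => ?_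
  rw [Finset.mem_Icc] at hj
  rw [hc, S.q_B_sum _ (fun k => by simpa using S.one_le_m k) (fun k _ => c k) k
    (Finset.mem_Icc.2 ⟨by omega, hj.2⟩), if_neg, zero_smul]
  simp only [Finset.mem_singleton]
  omega

theorem P1_of_mem {x : D} (hx : x ∈ S.D20) : S.P1 x = 0 := by
  rw [P1_apply, S.P20_of_mem hx, S.P2Sigma_of_mem hx]
  simp

theorem P20_P20 (x : D) : S.P20 (S.P20 x) = S.P20 x := S.P20_of_mem (S.P20_mem x)

theorem P20_eq_zero_iff (x : D) : S.P20 x = 0 ↔ ∀ i, S.q i 1 (B x) = 0 := by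
  constructor
  · intro h i
    rw [← q_B_P20, h, map_zero, map_zero]
  · intro h
    simp [P20, rankOneD, h]

theorem P1_mem (x : D) : S.P1 x ∈ S.D1 := ⟨x, rfl⟩

theorem P2Sigma_mem (x : D) : S.P2Sigma x ∈ S.D2Sigma := by
  rw [P2Sigma_apply]
  exact Submodule.sum_mem _ fun i _ => Submodule.sum_mem _ fun j hj =>
    Submodule.smul_mem _ _ (Submodule.subset_span ⟨i, j, hj, rfl⟩)

/-- `D₁ ∔ D₂Σ` is the kernel of `P₂₀`. -/
theorem mem_D1_sup_D2Sigma {u : D} (hu : S.P20 u = 0) : u ∈ S.D1 ⊔ S.D2Sigma := by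
  have h : u = S.P1 u + S.P2Sigma u := by rw [P1_apply, hu]; abel
  rw [h]
  exact Submodule.add_mem_sup (S.P1_mem u) (S.P2Sigma_mem u)

theorem Q2star_B_P1 (x : D) : S.Q2star (B (S.P1 x)) = 0 := by
  rw [Q2star_eq_zero_iff]
  intro i
  have h : S.P1 x = x - S.P2 x := rfl
  rw [h, map_sub, map_sub, P2_apply, S.q_B_sum _ (fun k => le_rfl) _ i (S.last_mem i),
    if_pos (S.last_mem i), sub_self]

/-! ### The operator `Ã` -/

theorem Atilde_apply (x : D) :
    S.Atilde x = A x + ∑ i, S.q i 1 (B x) • B (S.φ i (S.m i)) := by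
  simp [Atilde]

theorem q_last_Atilde (i : Fin n) (x : D) : S.q i (S.m i) (S.Atilde x) = S.q i 1 (B x) := by
  have h : ∑ i, S.q i 1 (B x) • B (S.φ i (S.m i)) =
      B (∑ k, ∑ j ∈ ({S.m k} : Finset ℕ), S.q k 1 (B x) • S.φ k j) := by simp
  rw [Atilde_apply, map_add, S.adjoint_last, zero_add, h,
    S.q_B_sum _ (fun k => by simpa using S.one_le_m k) (fun k _ => S.q k 1 (B x)) i (S.last_mem i)]
  simp

theorem Q2star_Atilde (x : D) : S.Q2star (S.Atilde x) = S.Atilde x - A x := by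
  have h : S.Q2star (S.Atilde x) = ∑ i, S.q i 1 (B x) • B (S.φ i (S.m i)) := by
    simp only [Q2star, rankOneY, _root_.sum_apply, ContinuousLinearMap.smulRight_apply,
      q_last_Atilde]
  rw [h, Atilde_apply, add_sub_cancel_left]

theorem Atilde_eq_A {x : D} (hx : S.P20 x = 0) : S.Atilde x = A x := by
  rw [P20_eq_zero_iff] at hx
  simp [Atilde_apply, hx]

theorem P20_eq_zero_of_Atilde_mem {x : D} (hx : S.Atilde x ∈ S.W) : S.P20 x = 0 := by
  rw [mem_W_iff, Q2star_eq_zero_iff] at hx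
  rw [P20_eq_zero_iff]
  intro i
  rw [← q_last_Atilde, hx]

theorem Atilde_injective : Function.Injective S.Atilde := by
  rw [injective_iff_map_eq_zero]
  intro x hx
  have h0 : S.P20 x = 0 := S.P20_eq_zero_of_Atilde_mem (by rw [hx]; exact zero_mem _)
  have h1 : x ∈ S.D20 := by
    change A x = 0
    rw [← S.Atilde_eq_A h0, hx]
  rw [← S.P20_of_mem h1, h0]

/-- The range of `Ã` is the preimage of the range of `A` under `I - Q₂*`. -/
theorem mem_range_Atilde_iff (y : Y) :
    y ∈ LinearMap.range S.Atilde ↔ y - S.Q2star y ∈ LinearMap.range A := by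
  constructor
  · rintro ⟨x, rfl⟩
    exact ⟨x, by rw [Q2star_Atilde]; abel⟩
  · rintro ⟨x, hx⟩
    -- shift `x` by an element of `ker A` so that its `ker A`-coordinates match those of `Q₂* y`
    set z : D := ∑ k, ∑ j ∈ ({1} : Finset ℕ), S.q k (S.m k) y • S.φ k j with hz
    have hqz : ∀ i, S.q i 1 (B z) = S.q i (S.m i) y := by
      intro i
      rw [hz, S.q_B_sum _ (fun k => by simpa using S.one_le_m k) (fun k _ => S.q k (S.m k) y) i
        (S.one_mem i)]
      simp
    have hAz : A z = 0 := by simp [hz, A_φ_one]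
    refine ⟨x - S.P20 x + z, ?_⟩
    have h1 : S.Atilde (x - S.P20 x) = A x := by
      rw [S.Atilde_eq_A (by rw [map_sub, P20_P20, sub_self]), map_sub, A_P20, sub_zero]
    have h2 : S.Atilde z = S.Q2star y := by
      simp [Atilde_apply, hAz, hqz, Q2star, rankOneY]
    rw [map_add, h1, h2, hx]
    abel

end CanonicalSystem

/-! ### Bijectivity of `Ã` -/

section Fredholm

variable {𝕜 E Y : Type*} [RCLike 𝕜] [NormedAddCommGroup E] [NormedSpace 𝕜 E] [CompleteSpace E]
  [NormedAddCommGroup Y] [NormedSpace 𝕜 Y] [CompleteSpace Y]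

/-- The Fredholm alternative for a finite rank perturbation of an isomorphism, in the direction
"injective implies surjective". -/
theorem surjective_of_injective_of_finite_rank {E Y : Type*} [AddCommGroup E] [Module 𝕜 E]
    [AddCommGroup Y] [Module 𝕜 Y] (U F : E →ₗ[𝕜] Y)
    (hU : Function.Bijective U) [FiniteDimensional 𝕜 (LinearMap.range F)]
    (hinj : Function.Injective (U + F)) : Function.Surjective (U + F) := by
  let e := LinearEquiv.ofBijective U hU
  have hUe : ∀ y, U (e.symm y) = y := e.apply_symm_apply
  -- `U + F` composed with `U⁻¹` maps the finite-dimensional range of `F` to itself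
  let h : LinearMap.range F →ₗ[𝕜] LinearMap.range F :=
    LinearMap.id + (F ∘ₗ e.symm.toLinearMap ∘ₗ (LinearMap.range F).subtype).codRestrict
      (LinearMap.range F) (fun z => ⟨_, rfl⟩)
  have hh : ∀ z, ((h z : LinearMap.range F) : Y) = (U + F) (e.symm z) := by
    intro z
    simp only [h, LinearMap.add_apply, LinearMap.id_apply, Submodule.coe_add, hUe]
    rfl
  have hhinj : Function.Injective h := by
    intro z z' hz
    have h1 : (U + F) (e.symm z) = (U + F) (e.symm z') := by rw [← hh, ← hh, hz]
    exact Subtype.ext (e.symm.injective (hinj h1))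
  intro y
  obtain ⟨z, hz⟩ := LinearMap.injective_iff_surjective.1 hhinj ⟨F (e.symm y), ⟨_, rfl⟩⟩
  refine ⟨e.symm y - e.symm z, ?_⟩
  rw [map_sub, ← hh, hz, LinearMap.add_apply, hUe]
  simp

/-- An injective operator `T` with closed range is onto if, up to a fixed operator `F` of finite
rank and up to arbitrarily small multiples of a bounded operator `b`, it is an isomorphism: the
lower bound of `T` persists for `T + μ b`, which has index zero, and then passes back to `T`. -/
theorem surjective_of_finite_rank_perturbation (T b F : E →L[𝕜] Y)
    (hinj : Function.Injective T) (hcl : IsClosed (Set.range T))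
    [FiniteDimensional 𝕜 (LinearMap.range F.toLinearMap)]
    (hpert : ∀ δ : ℝ, 0 < δ → ∃ μ : 𝕜, ‖μ‖ < δ ∧ Function.Bijective (T - F + μ • b)) :
    Function.Surjective T := by
  obtain ⟨K, hK⟩ := T.antilipschitz_of_injective_of_isClosed_range hinj hcl
  have hT : ∀ x, ‖x‖ ≤ K * ‖T x‖ := fun x => hK.le_mul_norm (map_zero _) x
  obtain ⟨μ, hμ, hbij⟩ := hpert (1 / (4 * (K + 1) * (‖b‖ + 1))) (by positivity)
  have hsmall : ‖μ‖ * ‖b‖ * K ≤ 1 / 4 := by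
    rw [lt_div_iff₀ (by positivity)] at hμ
    have h1 : ‖μ‖ * ‖b‖ * K ≤ ‖μ‖ * ((K + 1) * (‖b‖ + 1)) := by
      rw [mul_assoc]
      refine mul_le_mul_of_nonneg_left ?_ (norm_nonneg _)
      nlinarith [norm_nonneg b, K.coe_nonneg]
    linarith
  have hbx : ∀ x, K * ‖(μ • b) x‖ ≤ 1 / 4 * ‖x‖ := by
    intro x
    calc K * ‖(μ • b) x‖ ≤ K * (‖μ‖ * (‖b‖ * ‖x‖)) := by
          refine mul_le_mul_of_nonneg_left ?_ K.coe_nonneg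
          rw [smul_apply, norm_smul]
          exact mul_le_mul_of_nonneg_left (b.le_opNorm x) (norm_nonneg _)
      _ = ‖μ‖ * ‖b‖ * K * ‖x‖ := by ring
      _ ≤ 1 / 4 * ‖x‖ := mul_le_mul_of_nonneg_right hsmall (norm_nonneg _)
  have hS : ∀ x, ‖x‖ ≤ 2 * K * ‖(T + μ • b) x‖ := by
    intro x
    have h1 : ‖T x‖ ≤ ‖(T + μ • b) x‖ + ‖(μ • b) x‖ := by
      have : T x = (T + μ • b) x - (μ • b) x := by simp
      calc ‖T x‖ = ‖(T + μ • b) x - (μ • b) x‖ := by rw [← this]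
        _ ≤ _ := norm_sub_le _ _
    have h2 := mul_le_mul_of_nonneg_left h1 K.coe_nonneg
    have h3 := hbx x
    have h4 := hT x
    nlinarith [norm_nonneg x]
  have hSinj : Function.Injective (T + μ • b) := by
    rw [injective_iff_map_eq_zero]
    intro x hx
    have := hS x
    rw [hx, norm_zero, mul_zero] at this
    exact norm_le_zero_iff.1 this
  have hSsurj : Function.Surjective (T + μ • b) := by
    have heq : ∀ x, (T + μ • b) x = ((T - F + μ • b).toLinearMap + F.toLinearMap) x := by
      intro x
      simp only [_root_.add_apply, _root_.sub_apply, smul_apply, LinearMap.add_apply,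
        ContinuousLinearMap.coe_coe]
      abel
    have h := surjective_of_injective_of_finite_rank (T - F + μ • b).toLinearMap F.toLinearMap hbij
      (fun x y hxy => hSinj (by rw [heq, heq]; exact hxy))
    intro y
    obtain ⟨x, hx⟩ := h y
    exact ⟨x, by rw [heq, hx]⟩
  let e := ContinuousLinearEquiv.ofBijective (T + μ • b) (LinearMap.ker_eq_bot.2 hSinj)
    (LinearMap.range_eq_top.2 hSsurj)
  have he : ∀ y, (T + μ • b) (e.symm y) = y := e.apply_symm_apply
  have he' : ∀ x, e.symm ((T + μ • b) x) = x := e.symm_apply_apply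
  have hnorm : ‖(e.symm : Y →L[𝕜] E) ∘L (μ • b)‖ < 1 := by
    refine lt_of_le_of_lt (ContinuousLinearMap.opNorm_le_bound _ (M := 1 / 2) (by norm_num)
      fun x => ?_) (by norm_num)
    have h1 := hS (e.symm ((μ • b) x))
    rw [he] at h1
    have h2 := hbx x
    simp only [ContinuousLinearMap.coe_comp, Function.comp_apply, ContinuousLinearEquiv.coe_coe]
    linarith
  obtain ⟨u, hu⟩ := isUnit_one_sub_of_norm_lt_one hnorm
  intro y
  refine ⟨(↑u⁻¹ : E →L[𝕜] E) (e.symm y), ?_⟩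
  set z := (↑u⁻¹ : E →L[𝕜] E) (e.symm y) with hz
  have h1 : (↑u : E →L[𝕜] E) z = e.symm y := by
    have h3 : (↑u * ↑u⁻¹ : E →L[𝕜] E) (e.symm y) = e.symm y := by
      rw [Units.mul_inv]; rfl
    exact h3
  rw [hu] at h1
  have h2 : z - e.symm ((μ • b) z) = e.symm y := h1
  have h3 := congrArg (T + μ • b) h2
  rw [map_sub, he, he] at h3
  rw [← h3]
  simp

end Fredholm

section RegularPencil

variable {𝕜 : Type*} [RCLike 𝕜]

/-- A regular pencil provides isomorphisms `A + μ B` with arbitrarily small `μ`. -/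
theorem IsRegularPencilOfIndex.exists_small_bijective {D Y : Type*}
    [NormedAddCommGroup D] [NormedSpace 𝕜 D]
    [NormedAddCommGroup Y] [NormedSpace 𝕜 Y] {A B : D →ₗ[𝕜] Y} {ν : ℕ}
    (h : IsRegularPencilOfIndex A B ν) {δ : ℝ} (hδ : 0 < δ) :
    ∃ μ : 𝕜, ‖μ‖ < δ ∧ Function.Bijective (A + μ • B) := by
  obtain ⟨R, hR⟩ : ∃ R : ℝ, ∀ r : ℝ, R < r → Function.Bijective (pencil A B (r : 𝕜)) := by
    by_cases hI : (RCLike.I : 𝕜) = 0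
    · obtain ⟨⟨R, hR, hb⟩, -⟩ := h.2 hI
      refine ⟨R, fun r hr => ?_⟩
      have hrpos : 0 < r := hR.trans hr
      have hbij := (hb (r : ℂ) (by simpa [abs_of_pos hrpos] using hr)).1
      have hform : ∀ x : D × D, complexifiedPencil A B (r : ℂ) x =
          (pencil A B (r : 𝕜) x.1, pencil A B (r : 𝕜) x.2) := by
        intro x
        simp [complexifiedPencil, pencil]
      constructor
      · intro x y hxy
        have := hbij.1 (a₁ := (x, x)) (a₂ := (y, y)) (by rw [hform, hform]; simp [hxy])
        exact (Prod.mk.inj this).1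
      · intro y
        obtain ⟨x, hx⟩ := hbij.2 (y, y)
        rw [hform] at hx
        exact ⟨x.1, (Prod.mk.inj hx).1⟩
    · obtain ⟨⟨R, hR, hb⟩, -⟩ := h.1 hI
      refine ⟨R, fun r hr => (hb (r : 𝕜) ?_).1⟩
      simpa [abs_of_pos (hR.trans hr)] using hr
  set r : ℝ := max R (δ⁻¹) + 1 with hr
  have hrδ : δ⁻¹ < r := lt_of_le_of_lt (le_max_right _ _) (lt_add_one _)
  have hrpos : 0 < r := lt_trans (by positivity) hrδ
  have hbij := hR r (lt_of_le_of_lt (le_max_left _ _) (lt_add_one _))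
  have hr0 : (r : 𝕜) ≠ 0 := by exact_mod_cast hrpos.ne'
  refine ⟨(r : 𝕜)⁻¹, ?_, ?_⟩
  · rw [norm_inv, RCLike.norm_ofReal, abs_of_pos hrpos]
    exact inv_lt_of_inv_lt₀ hδ hrδ
  · have heq : ∀ x, pencil A B (r : 𝕜) x = (r : 𝕜) • (A + (r : 𝕜)⁻¹ • B) x := by
      intro x
      simp [pencil, smul_smul, hr0]
    constructor
    · intro x y hxy
      exact hbij.1 (by rw [heq, heq, hxy])
    · intro y
      obtain ⟨x, hx⟩ := hbij.2 ((r : 𝕜) • y)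
      refine ⟨x, ?_⟩
      rw [heq] at hx
      exact smul_right_injective Y hr0 hx

/-- The estimates on a pencil `A, B : D → Y` and its operator `Ã` that do not involve the
completeness of `D`: `B` is bounded relative to `A`, the operator `A` is closed as far as limits in
`D` are concerned, and `Ã` is a bijection whose inverse is bounded into the graph norm. -/
structure CanonicalSystem.IsTame {D Y : Type*} [NormedAddCommGroup D] [NormedSpace 𝕜 D]
    [NormedAddCommGroup Y] [NormedSpace 𝕜 Y] {A B : D →ₗ[𝕜] Y} {ν n : ℕ}
    (S : CanonicalSystem A B ν n) : Prop where
  bijective : Function.Bijective S.Atilde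
  exists_bound : ∃ C : ℝ, 0 ≤ C ∧ ∀ x, ‖x‖ ≤ C * ‖S.Atilde x‖ ∧ ‖B x‖ ≤ C * ‖S.Atilde x‖
  exists_bound_B : ∃ C : ℝ, 0 ≤ C ∧ ∀ x, ‖B x‖ ≤ C * (‖x‖ + ‖A x‖)
  closed : ∀ (l : Filter ℝ) [l.NeBot] (x : ℝ → D) (x' : D) (y : Y),
    Tendsto x l (𝓝 x') → Tendsto (fun t => A (x t)) l (𝓝 y) → A x' = y

variable {X Y : Type*}
    [NormedAddCommGroup X] [NormedSpace 𝕜 X] [CompleteSpace X]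
    [NormedAddCommGroup Y] [NormedSpace 𝕜 Y] [CompleteSpace Y]

theorem CanonicalSystem.isTame (A B : X →ₗ.[𝕜] Y) (hA : A.IsClosed) (hB : B.IsClosed)
    (hA_range : IsClosed (LinearMap.range A.toFun : Set Y))
    (hAB : A.domain ≤ B.domain) (ν n : ℕ)
    (B' : A.domain →ₗ[𝕜] Y) (hB' : B' = restrictTo B A.domain hAB)
    (hν : IsRegularPencilOfIndex A.toFun B' ν)
    (S : CanonicalSystem A.toFun B' ν n) : S.IsTame := by
  have hclosed : ∀ (l : Filter ℝ) [l.NeBot] (x : ℝ → A.domain) (x' : A.domain) (y : Y),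
      Tendsto x l (𝓝 x') → Tendsto (fun t => A.toFun (x t)) l (𝓝 y) → A.toFun x' = y := by
    intro l _ x x' y hx hy
    have h1 : Tendsto (fun t => ((x t : X), A.toFun (x t))) l (𝓝 ((x' : X), y)) :=
      ((continuous_subtype_val.tendsto x').comp hx).prodMk_nhds hy
    have h2 : ((x' : X), y) ∈ A.graph :=
      hA.mem_of_tendsto h1 (Eventually.of_forall fun t => A.mem_graph (x t))
    obtain ⟨z, hz1, hz2⟩ := A.mem_graph_iff.1 h2
    have hzx : z = x' := Subtype.ext hz1
    rw [← hzx]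
    exact hz2
  have : CompleteSpace A.graph := hA.completeSpace_coe
  -- the domain with the graph norm is the Banach space `A.graph`
  let e : A.domain ≃ₗ[𝕜] A.graph := LinearEquiv.ofBijective
    ((LinearMap.prod A.domain.subtype A.toFun).codRestrict A.graph fun x => A.mem_graph x)
    ⟨fun x y h => Subtype.ext (congrArg (fun z : A.graph => (z : X × Y).1) h), by
      rintro ⟨p, hp⟩
      obtain ⟨x, hx1, hx2⟩ := A.mem_graph_iff.1 hp
      exact ⟨x, Subtype.ext (Prod.ext hx1 hx2)⟩⟩
  have he : ∀ x, (e x : X × Y) = ((x : X), A.toFun x) := fun _ => rfl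
  have hnorm : ∀ x, ‖e x‖ = max ‖x‖ ‖A.toFun x‖ := fun _ => rfl
  have hesymm : ∀ z : A.graph, ((e.symm z : A.domain) : X) = (z : X × Y).1 := fun z => by
    have := he (e.symm z)
    rw [e.apply_symm_apply] at this
    rw [this]
  have hesymm2 : ∀ z : A.graph, A.toFun (e.symm z) = (z : X × Y).2 := fun z => by
    have := he (e.symm z)
    rw [e.apply_symm_apply] at this
    rw [this]
  let a : A.graph →L[𝕜] Y := (ContinuousLinearMap.snd 𝕜 X Y) ∘L A.graph.subtypeL
  have ha : ∀ z, a z = A.toFun (e.symm z) := fun z => (hesymm2 z).symm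
  let b : A.graph →L[𝕜] Y :=
    ⟨B' ∘ₗ e.symm.toLinearMap, by
      refine LinearMap.continuous_of_seq_closed_graph _ ?_
      intro u z y hu huy
      have h1 : Tendsto (fun k => (((e.symm (u k) : A.domain) : X), B' (e.symm (u k)))) atTop
          (𝓝 (((e.symm z : A.domain) : X), y)) := by
        refine Tendsto.prodMk_nhds ?_ huy
        simp only [hesymm]
        exact (continuous_fst.comp continuous_subtype_val).continuousAt.tendsto.comp hu
      have h2 : (((e.symm z : A.domain) : X), y) ∈ B.graph :=
        hB.mem_of_tendsto h1 (Eventually.of_forall fun k =>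
          hB' ▸ B.mem_graph (Submodule.inclusion hAB (e.symm (u k))))
      obtain ⟨x, hx1, hx2⟩ := B.mem_graph_iff.1 h2
      have hx : x = Submodule.inclusion hAB (e.symm z) := Subtype.ext hx1
      refine hx2.symm.trans ?_
      rw [hx, hB']
      rfl⟩
  have hb : ∀ z, b z = B' (e.symm z) := fun _ => rfl
  let F : A.graph →L[𝕜] Y := ∑ i, ((S.q i 1) ∘L b).smulRight (B' (S.φ i (S.m i)))
  have hTF : ∀ z, (a + F) z = S.Atilde (e.symm z) := by
    intro z
    simp [F, CanonicalSystem.Atilde_apply, ha, hb]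
  have hTinj : Function.Injective (a + F) := by
    intro z z' h
    rw [hTF, hTF] at h
    exact e.symm.injective (S.Atilde_injective h)
  have hrange : Set.range (a + F) = (fun y => y - S.Q2star y) ⁻¹' (LinearMap.range A.toFun) := by
    ext y
    rw [Set.mem_preimage, SetLike.mem_coe, ← S.mem_range_Atilde_iff]
    constructor
    · rintro ⟨z, rfl⟩
      exact ⟨e.symm z, (hTF z).symm⟩
    · rintro ⟨x, rfl⟩
      exact ⟨e x, by rw [hTF, e.symm_apply_apply]⟩
  have hcl : IsClosed (Set.range (a + F)) := by
    rw [hrange]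
    exact hA_range.preimage (continuous_id.sub S.Q2star.continuous)
  have : FiniteDimensional 𝕜 (LinearMap.range F.toLinearMap) := by
    have hle : LinearMap.range F.toLinearMap ≤
        Submodule.span 𝕜 (Set.range fun i => B' (S.φ i (S.m i))) := by
      rintro _ ⟨z, rfl⟩
      change F z ∈ _
      simp only [F, _root_.sum_apply, ContinuousLinearMap.smulRight_apply]
      exact Submodule.sum_mem _ fun i _ =>
        Submodule.smul_mem _ _ (Submodule.subset_span ⟨i, rfl⟩)
    have : FiniteDimensional 𝕜 (Submodule.span 𝕜 (Set.range fun i => B' (S.φ i (S.m i)))) :=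
      FiniteDimensional.span_of_finite 𝕜 (Set.finite_range _)
    exact Submodule.finiteDimensional_of_le hle
  have hsurj := surjective_of_finite_rank_perturbation (a + F) b F hTinj hcl (by
    intro δ hδ
    obtain ⟨μ, hμ, hbij⟩ := hν.exists_small_bijective hδ
    refine ⟨μ, hμ, ?_⟩
    have : ⇑(a + F - F + μ • b) = (A.toFun + μ • B') ∘ e.symm := by
      ext z
      simp [ha, hb]
    rw [this]
    exact hbij.comp e.symm.bijective)
  refine ⟨⟨S.Atilde_injective, fun y => ?_⟩, ?_, ⟨‖b‖, b.opNorm_nonneg, fun x => ?_⟩, hclosed⟩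
  · obtain ⟨z, hz⟩ := hsurj y
    exact ⟨e.symm z, by rw [← hTF, hz]⟩
  · obtain ⟨K, hK⟩ := (a + F).antilipschitz_of_injective_of_isClosed_range hTinj hcl
    have h1 : ∀ x, ‖e x‖ ≤ K * ‖S.Atilde x‖ := fun x => by
      have := hK.le_mul_norm (map_zero _) (e x)
      rwa [hTF, e.symm_apply_apply] at this
    refine ⟨K * (‖b‖ + 1), by positivity, fun x => ⟨?_, ?_⟩⟩
    · have h2 : ‖x‖ ≤ ‖e x‖ := by rw [hnorm]; exact le_max_left _ _
      have h3 : 0 ≤ K * ‖S.Atilde x‖ * ‖b‖ := by positivity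
      nlinarith [h1 x]
    · have h2 : ‖B' x‖ ≤ ‖b‖ * ‖e x‖ := by
        have := b.le_opNorm (e x)
        rwa [hb, e.symm_apply_apply] at this
      have h3 := mul_le_mul_of_nonneg_left (h1 x) (norm_nonneg b)
      have h4 : 0 ≤ K * ‖S.Atilde x‖ := by positivity
      nlinarith
  · have h2 : ‖B' x‖ ≤ ‖b‖ * ‖e x‖ := by
      have := b.le_opNorm (e x)
      rwa [hb, e.symm_apply_apply] at this
    refine h2.trans (mul_le_mul_of_nonneg_left ?_ b.opNorm_nonneg)
    rw [hnorm]
    exact max_le_add_of_nonneg (norm_nonneg _) (norm_nonneg _)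

end RegularPencil

/-! ### Global solutions of differential equations in Banach spaces -/

section ODE

variable {E : Type*} [NormedAddCommGroup E] [NormedSpace ℝ E]

/-- `w` solves `w' = G(t, w)` on `[a, b]` in the sense of right derivatives. This notion behaves
well under restriction and concatenation; for continuous `G` it agrees with the classical one. -/
structure IsRightSolution (G : ℝ → E → E) (w : ℝ → E) (a b : ℝ) : Prop where
  continuousOn : ContinuousOn w (Icc a b)
  hasDerivWithinAt : ∀ t ∈ Ico a b, HasDerivWithinAt w (G t (w t)) (Ici t) t

/-- `G` is locally Lipschitz in the second variable, locally uniformly in the first. -/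
def IsLocallyLipschitz {E F : Type*} [NormedAddCommGroup E] [NormedAddCommGroup F]
    (G : ℝ → E → F) : Prop :=
  ∀ t' : ℝ, ∀ x' : E, ∃ r : ℝ, 0 < r ∧ ∃ L : ℝ, 0 ≤ L ∧
    ∀ t : ℝ, |t - t'| < r → ∀ x y : E, ‖x - x'‖ < r → ‖y - x'‖ < r →
      ‖G t x - G t y‖ ≤ L * ‖x - y‖

variable {G : ℝ → E → E} {w v : ℝ → E} {a b c : ℝ}

theorem IsRightSolution.mono (h : IsRightSolution G w a b) {a' b' : ℝ} (ha : a ≤ a') (hb : b' ≤ b) :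
    IsRightSolution G w a' b' :=
  ⟨h.continuousOn.mono (Icc_subset_Icc ha hb), fun t ht =>
    h.hasDerivWithinAt t ⟨ha.trans ht.1, ht.2.trans_le hb⟩⟩

theorem IsRightSolution.congr (h : IsRightSolution G w a b) (hv : EqOn v w (Icc a b)) :
    IsRightSolution G v a b := by
  refine ⟨h.continuousOn.congr hv, fun t ht => ?_⟩
  rw [hv ⟨ht.1, ht.2.le⟩]
  refine (h.hasDerivWithinAt t ht).congr_of_eventuallyEq ?_ (hv ⟨ht.1, ht.2.le⟩)
  filter_upwards [Icc_mem_nhdsGE ht.2] with s hs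
  exact hv ⟨ht.1.trans hs.1, hs.2⟩

theorem IsRightSolution.concat (hab : a ≤ b) (hw : IsRightSolution G w a b)
    (hv : IsRightSolution G v b c) (h : w b = v b) :
    IsRightSolution G (fun t => if t ≤ b then w t else v t) a c := by
  have h1 : EqOn (fun t => if t ≤ b then w t else v t) w (Icc a b) := fun t ht => if_pos ht.2
  have h2 : EqOn (fun t => if t ≤ b then w t else v t) v (Icc b c) := by
    intro t ht
    rcases eq_or_lt_of_le ht.1 with rfl | hlt
    · simp [h]
    · simp [not_le.2 hlt]
  have hw' := hw.congr h1
  have hv' := hv.congr h2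
  refine ⟨?_, fun t ht => ?_⟩
  · rcases le_total b c with hbc | hbc
    · rw [← Icc_union_Icc_eq_Icc hab hbc]
      exact hw'.continuousOn.union_of_isClosed hv'.continuousOn isClosed_Icc isClosed_Icc
    · exact hw'.continuousOn.mono (Icc_subset_Icc_right hbc)
  · rcases lt_or_ge t b with hlt | hge
    · exact hw'.hasDerivWithinAt t ⟨ht.1, hlt⟩
    · exact hv'.hasDerivWithinAt t ⟨hge, ht.2⟩

theorem IsRightSolution.continuousOn_field (hG : Continuous fun p : ℝ × E => G p.1 p.2)
    (h : IsRightSolution G w a b) : ContinuousOn (fun t => G t (w t)) (Icc a b) :=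
  hG.comp_continuousOn (continuousOn_id.prodMk h.continuousOn)

theorem IsRightSolution.eqOn (hL : IsLocallyLipschitz G) (hw : IsRightSolution G w a b)
    (hv : IsRightSolution G v a b) (h : w a = v a) : EqOn w v (Icc a b) := by
  refine IsClosed.Icc_subset_of_forall_exists_gt (s := {t | w t = v t}) ?_ h ?_
  · rw [inter_comm]
    exact (hw.continuousOn.prodMk hv.continuousOn).preimage_isClosed_of_isClosed isClosed_Icc
      isClosed_diagonal
  · rintro x ⟨hx, hxa, hxb⟩ y hy
    obtain ⟨r, hr, L, hL0, hLr⟩ := hL x (w x)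
    have hnear : ∀ u : ℝ → E, ContinuousOn u (Icc a b) → u x = w x →
        ∀ᶠ t in 𝓝[≥] x, ‖u t - w x‖ < r := by
      intro u hu hux
      have h1 : ContinuousWithinAt u (Ici x) x :=
        (hu x ⟨hxa, hxb.le⟩).mono_of_mem_nhdsWithin
          (mem_of_superset (Icc_mem_nhdsGE hxb) (Icc_subset_Icc_left hxa))
      have h2 := h1.tendsto.eventually (Metric.ball_mem_nhds (u x) hr)
      filter_upwards [h2] with t ht
      rw [← hux, ← dist_eq_norm]
      exact ht
    have htime : ∀ᶠ t in 𝓝[≥] x, |t - x| < r := by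
      have : ∀ᶠ t in 𝓝 x, |t - x| < r := Metric.ball_mem_nhds x hr
      exact this.filter_mono nhdsWithin_le_nhds
    have hall := ((hnear w hw.continuousOn rfl).and (hnear v hv.continuousOn (Eq.symm hx))).and
      (htime.and (Icc_mem_nhdsGE (lt_min hxb hy)))
    obtain ⟨d, hd, hsub⟩ := (mem_nhdsGE_iff_exists_Icc_subset).1 hall
    have heq := ODE_solution_unique_of_mem_Icc_right (v := G) (K := ⟨L, hL0⟩) (f := w) (g := v)
      (a := x) (b := d) (s := fun _ => Metric.ball (w x) r)
      (fun t ht => LipschitzOnWith.of_dist_le_mul fun p hp q hq => by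
        rw [dist_eq_norm, dist_eq_norm]
        rw [Metric.mem_ball, dist_eq_norm] at hp hq
        exact hLr t (hsub ⟨ht.1, ht.2.le⟩).2.1 p q hp hq)
      (hw.continuousOn.mono fun t ht => ⟨hxa.trans ht.1, ((hsub ht).2.2.2).trans (min_le_left _ _)⟩)
      (fun t ht => hw.hasDerivWithinAt t ⟨hxa.trans ht.1, lt_of_lt_of_le ht.2
        (((hsub (right_mem_Icc.2 (le_of_lt hd))).2.2.2).trans (min_le_left _ _))⟩)
      (fun t ht => by
        rw [Metric.mem_ball, dist_eq_norm]; exact (hsub ⟨ht.1, ht.2.le⟩).1.1)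
      (hv.continuousOn.mono fun t ht => ⟨hxa.trans ht.1, ((hsub ht).2.2.2).trans (min_le_left _ _)⟩)
      (fun t ht => hv.hasDerivWithinAt t ⟨hxa.trans ht.1, lt_of_lt_of_le ht.2
        (((hsub (right_mem_Icc.2 (le_of_lt hd))).2.2.2).trans (min_le_left _ _))⟩)
      (fun t ht => by
        rw [Metric.mem_ball, dist_eq_norm]; exact (hsub ⟨ht.1, ht.2.le⟩).1.2)
      hx
    have hdm := right_mem_Icc.2 (le_of_lt hd)
    exact ⟨d, heq hdm, hd, ((hsub hdm).2.2.2).trans (min_le_right _ _)⟩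

variable [CompleteSpace E]

theorem IsRightSolution.hasDerivAt (hG : Continuous fun p : ℝ × E => G p.1 p.2)
    (h : IsRightSolution G w a b) {t : ℝ} (ht : t ∈ Ioo a b) : HasDerivAt w (G t (w t)) t := by
  have hab : a ≤ b := (ht.1.trans ht.2).le
  set g : ℝ → E := IccExtend hab ((Icc a b).domRestrict fun t => G t (w t)) with hg
  have hgc : Continuous g := (h.continuousOn_field hG).domRestrict.Icc_extend'
  have hgeq : ∀ s ∈ Icc a b, g s = G s (w s) := fun s hs => by
    rw [hg, IccExtend_of_mem _ _ hs]; rfl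
  set u : ℝ → E := fun s => w a + ∫ τ in a..s, g τ with hu
  have hud : ∀ s, HasDerivAt u (g s) s := fun s =>
    (intervalIntegral.integral_hasDerivAt_right (hgc.intervalIntegrable _ _)
      hgc.aestronglyMeasurable.stronglyMeasurableAtFilter hgc.continuousAt).const_add _
  have heq : ∀ s ∈ Icc a b, w s = u s := eq_of_has_deriv_right_eq
    (fun s hs => h.hasDerivWithinAt s hs)
    (fun s hs => by rw [← hgeq s ⟨hs.1, hs.2.le⟩]; exact (hud s).hasDerivWithinAt)
    h.continuousOn (fun s _ => (hud s).continuousAt.continuousWithinAt) (by simp [hu])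
  rw [← hgeq t ⟨ht.1.le, ht.2.le⟩]
  refine (hud t).congr_of_eventuallyEq ?_
  filter_upwards [Icc_mem_nhds ht.1 ht.2] with s hs using heq s hs

theorem exists_isRightSolution (hG : Continuous fun p : ℝ × E => G p.1 p.2)
    (hL : IsLocallyLipschitz G) (a : ℝ) (x₀ : E) :
    ∃ ε : ℝ, 0 < ε ∧ ∃ w : ℝ → E, w a = x₀ ∧ IsRightSolution G w a (a + ε) := by
  obtain ⟨r, hr, L, hL0, hLr⟩ := hL a x₀
  obtain ⟨r', hr', hb⟩ := Metric.continuousAt_iff.1 (hG.continuousAt (x := (a, x₀))) 1 one_pos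
  set M : ℝ := ‖G a x₀‖ + 1 with hM
  have hMpos : 0 < M := by positivity
  set ρ : ℝ := min r r' / 2 with hρ
  have hρpos : 0 < ρ := by positivity
  have hρr : ρ < r := by have := min_le_left r r'; linarith
  have hρr' : ρ < r' := by have := min_le_right r r'; linarith
  set ε : ℝ := min ρ (ρ / M) with hε
  have hεpos : 0 < ε := by positivity
  have hεr : ε ≤ ρ := min_le_left _ _
  have hat : ∀ t ∈ Icc a (a + ε), |t - a| ≤ ρ := fun t ht => by
    rw [abs_of_nonneg (by linarith [ht.1])]; linarith [ht.2]
  have hPL : IsPicardLindelof G (tmin := a) (tmax := a + ε) ⟨a, left_mem_Icc.2 (by linarith)⟩ x₀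
      ⟨ρ, hρpos.le⟩ 0 ⟨M, hMpos.le⟩ ⟨L, hL0⟩ := by
    refine ⟨fun t ht => LipschitzOnWith.of_dist_le_mul fun p hp q hq => ?_, fun x _ => ?_,
      fun t ht x hx => ?_, ?_⟩
    · rw [dist_eq_norm, dist_eq_norm]
      rw [Metric.mem_closedBall, dist_eq_norm] at hp hq
      exact hLr t ((hat t ht).trans_lt hρr) p q (hp.trans_lt hρr) (hq.trans_lt hρr)
    · exact (hG.comp (continuous_id.prodMk continuous_const)).continuousOn
    · have h1 : dist ((t, x) : ℝ × E) (a, x₀) < r' := by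
        rw [Prod.dist_eq]
        refine max_lt ?_ (lt_of_le_of_lt hx hρr')
        rw [Real.dist_eq]
        exact (hat t ht).trans_lt hρr'
      have h2 := hb h1
      rw [dist_eq_norm] at h2
      have h3 := norm_sub_norm_le (G t x) (G a x₀)
      change ‖G t x‖ ≤ M
      simp only at h2
      linarith
    · change M * max (a + ε - a) (a - a) ≤ ρ - 0
      rw [sub_self, add_sub_cancel_left, max_eq_left hεpos.le, sub_zero]
      calc M * ε ≤ M * (ρ / M) := mul_le_mul_of_nonneg_left (min_le_right _ _) hMpos.le
        _ = ρ := by field_simp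
  obtain ⟨w, hw0, hw⟩ := hPL.exists_eq_forall_mem_Icc_hasDerivWithinAt₀
  refine ⟨ε, hεpos, w, hw0, fun t ht => (hw t ht).continuousWithinAt, fun t ht => ?_⟩
  exact (hw t ⟨ht.1, ht.2.le⟩).mono_of_mem_nhdsWithin
    (mem_of_superset (Icc_mem_nhdsGE ht.2) (Icc_subset_Icc_left ht.1))

/-- A solution exists for all times if every solution on a bounded half-open interval has a limit at
the right end point. -/
theorem exists_global_isRightSolution (hG : Continuous fun p : ℝ × E => G p.1 p.2)
    (hL : IsLocallyLipschitz G) (a : ℝ) (x₀ : E)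
    (H : ∀ T : ℝ, a < T → ∀ w : ℝ → E, (∀ b < T, IsRightSolution G w a b) →
      ∃ l, Tendsto w (𝓝[<] T) (𝓝 l)) :
    ∃ w : ℝ → E, w a = x₀ ∧ ∀ b, IsRightSolution G w a b := by
  set P : ℝ → Prop := fun b => ∃ w : ℝ → E, w a = x₀ ∧ IsRightSolution G w a b with hP
  -- by uniqueness, if `u b` is a solution on `[a, b]`, these solutions are all restrictions of the
  -- diagonal function `t ↦ u t t`
  have glue : ∀ s : Set ℝ, (∀ b ∈ s, P b) → (∀ b ∈ s, ∃ c ∈ s, b < c) →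
      ∃ w : ℝ → E, (a ∈ s → w a = x₀) ∧ ∀ b, (∀ c, a ≤ c → c ≤ b → c ∈ s) →
        IsRightSolution G w a b := by
    intro s hs hs'
    choose! u hu0 hu using hs
    refine ⟨fun t => u t t, fun ha => hu0 a ha, fun b hb => ?_⟩
    rcases lt_or_ge b a with hlt | hge
    · exact ⟨by simp [Icc_eq_empty (not_le.2 hlt)], fun t ht => by
        exact absurd (ht.1.trans_lt ht.2) (not_lt.2 hlt.le)⟩
    · refine (hu b (hb b hge le_rfl)).congr fun t ht => ?_
      have hts := hb t ht.1 ht.2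
      exact (hu t hts).eqOn hL ((hu b (hb b hge le_rfl)).mono le_rfl ht.2)
        ((hu0 t hts).trans (hu0 b (hb b hge le_rfl)).symm) ⟨ht.1, le_rfl⟩
  have mono : ∀ b c, b ≤ c → P c → P b := fun b c hbc ⟨w, hw0, hw⟩ => ⟨w, hw0, hw.mono le_rfl hbc⟩
  have ext : ∀ b, a ≤ b → P b → ∃ c, b < c ∧ P c := by
    rintro b hab ⟨w, hw0, hw⟩
    obtain ⟨ε, hε, v, hv0, hv⟩ := exists_isRightSolution hG hL b (w b)
    exact ⟨b + ε, by linarith, _, by simp [hab, hw0], hw.concat hab hv hv0.symm⟩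
  have ha : P a := by
    obtain ⟨ε, hε, v, hv0, hv⟩ := exists_isRightSolution hG hL a x₀
    exact ⟨v, hv0, hv.mono le_rfl (by linarith)⟩
  have hall : ∀ b, P b := by
    by_contra! hne
    obtain ⟨b, hb⟩ := hne
    have hbdd : BddAbove {c | P c} := ⟨b, fun c hc => by
      by_contra! hlt
      exact hb (mono b c hlt.le hc)⟩
    set T := sSup {c | P c} with hT
    obtain ⟨c, hac, hc⟩ := ext a le_rfl ha
    have haT : a < T := hac.trans_le (le_csSup hbdd hc)
    have hlt : ∀ b < T, P b := fun b hb => by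
      obtain ⟨c, hc, hbc⟩ := exists_lt_of_lt_csSup ⟨a, ha⟩ hb
      exact mono b c hbc.le hc
    obtain ⟨w, hw0, hw⟩ := glue (Iio T) hlt (fun b hb => by
      obtain ⟨c, hbc, hc⟩ := exists_between (show b < T from hb)
      exact ⟨c, hc, hbc⟩)
    have hw' : ∀ b < T, IsRightSolution G w a b := fun b hb => hw b fun c _ hc => hc.trans_lt hb
    obtain ⟨l, hl⟩ := H T haT w hw'
    have heq : EqOn (Function.update w T l) w (Iio T) := fun t ht =>
      Function.update_of_ne (ne_of_lt ht) _ _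
    have hPT : P T := by
      refine ⟨Function.update w T l, by rw [heq haT, hw0 haT], ?_, fun t ht => ?_⟩
      · intro t ht
        rcases eq_or_lt_of_le ht.2 with rfl | htT
        · rw [continuousWithinAt_update_same]
          refine hl.mono_left (nhdsWithin_mono _ ?_)
          rintro s ⟨hs, hs'⟩
          exact lt_of_le_of_ne hs.2 hs'
        · obtain ⟨c, htc, hcT⟩ := exists_between htT
          have h1 := (((hw' c hcT).congr fun s hs => heq (hs.2.trans_lt hcT)).continuousOn t
            ⟨ht.1, htc.le⟩)
          refine h1.mono_of_mem_nhdsWithin ?_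
          filter_upwards [self_mem_nhdsWithin, mem_nhdsWithin_of_mem_nhds (Iio_mem_nhds htc)]
            with s hs hsc using ⟨hs.1, le_of_lt hsc⟩
      · obtain ⟨c, htc, hcT⟩ := exists_between ht.2
        exact ((hw' c hcT).congr fun s hs => heq (hs.2.trans_lt hcT)).hasDerivWithinAt t ⟨ht.1, htc⟩
    obtain ⟨c, hTc, hc⟩ := ext T haT.le hPT
    exact absurd (le_csSup hbdd hc) (not_le.2 hTc)
  obtain ⟨w, hw0, hw⟩ := glue univ (fun b _ => hall b) (fun b _ => ⟨b + 1, mem_univ _, by linarith⟩)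
  exact ⟨w, hw0 (mem_univ _), fun b => hw b fun _ _ _ => mem_univ _⟩

/-- If the right-hand side is bounded on bounded sets, a solution on `[a, T)` without a limit at `T`
blows up in norm. -/
theorem tendsto_or_norm_tendsto_atTop {T : ℝ} (haT : a < T)
    (hbdd : ∀ ρ : ℝ, ∃ C : ℝ, ∀ t ∈ Ico a T, ∀ x, ‖x‖ ≤ ρ → ‖G t x‖ ≤ C)
    (hw : ∀ b < T, IsRightSolution G w a b) :
    (∃ l, Tendsto w (𝓝[<] T) (𝓝 l)) ∨ Tendsto (fun t => ‖w t‖) (𝓝[<] T) atTop := by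
  by_cases hinf : Tendsto (fun t => ‖w t‖) (𝓝[<] T) atTop
  · exact Or.inr hinf
  left
  rw [tendsto_atTop] at hinf
  push Not at hinf
  obtain ⟨ρ, hρ⟩ := hinf
  obtain ⟨C₀, hC₀⟩ := hbdd (ρ + 1)
  set C := max C₀ 0 with hC
  have hCnn : 0 ≤ C := le_max_right _ _
  have hCb : ∀ t ∈ Ico a T, ∀ x, ‖x‖ ≤ ρ + 1 → ‖G t x‖ ≤ C := fun t ht x hx =>
    (hC₀ t ht x hx).trans (le_max_left _ _)
  -- a time so close to `T` that the trajectory cannot leave the ball of radius `ρ + 1`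
  obtain ⟨s, hsρ, hs⟩ := (hρ.and_eventually
    (Ico_mem_nhdsLT (max_lt haT (show T - 1 / (C + 1) < T by
      have : 0 < 1 / (C + 1) := by positivity
      linarith)))).exists
  have hsa : a ≤ s := (le_max_left _ _).trans hs.1
  have hsC : (C + 1) * (T - s) ≤ 1 := by
    have h1 : T - s ≤ 1 / (C + 1) := by linarith [(le_max_right a (T - 1 / (C + 1))).trans hs.1]
    calc (C + 1) * (T - s) ≤ (C + 1) * (1 / (C + 1)) :=
          mul_le_mul_of_nonneg_left h1 (by positivity)
      _ = 1 := by field_simp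
  have hball : ∀ t ∈ Ico s T, ‖w t‖ ≤ ρ + 1 := by
    intro t ht
    have hsol := (hw t ht.2).mono hsa le_rfl
    have h1 := image_norm_le_of_norm_deriv_right_lt_deriv_boundary
      (B := fun τ => ρ + (C + 1) * (τ - s))
      (B' := fun _ => C + 1) hsol.continuousOn hsol.hasDerivWithinAt (by simpa using hsρ.le)
      (fun τ => by
        simpa using (((hasDerivAt_id τ).sub_const s).const_mul (C + 1)).const_add ρ)
      (fun τ hτ hτeq => by
        refine lt_of_le_of_lt (hCb τ ⟨hsa.trans hτ.1, hτ.2.trans ht.2⟩ _ ?_) (lt_add_one C)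
        rw [hτeq]
        have : (C + 1) * (τ - s) ≤ (C + 1) * (T - s) :=
          mul_le_mul_of_nonneg_left (by linarith [hτ.2, ht.2]) (by positivity)
        linarith) ⟨ht.1, le_rfl⟩
    have : (C + 1) * (t - s) ≤ (C + 1) * (T - s) :=
      mul_le_mul_of_nonneg_left (by linarith [ht.2]) (by positivity)
    linarith
  have hlip : ∀ p ∈ Ico s T, ∀ q ∈ Ico s T, p ≤ q → ‖w q - w p‖ ≤ C * (q - p) := by
    intro p hp q hq hpq
    have hsol := (hw q hq.2).mono (hsa.trans hp.1) le_rfl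
    exact norm_image_sub_le_of_norm_deriv_right_le_segment hsol.continuousOn hsol.hasDerivWithinAt
      (fun τ hτ => hCb τ ⟨hsa.trans (hp.1.trans hτ.1), hτ.2.trans hq.2⟩ _
        (hball τ ⟨hp.1.trans hτ.1, hτ.2.trans hq.2⟩)) q ⟨hpq, le_rfl⟩
  have hLip : LipschitzOnWith ⟨C, hCnn⟩ w (Ico s T) := by
    refine LipschitzOnWith.of_dist_le_mul fun p hp q hq => ?_
    change dist (w p) (w q) ≤ C * dist p q
    rcases le_total p q with h | h
    · rw [dist_comm, dist_eq_norm, dist_comm, Real.dist_eq, abs_of_nonneg (by linarith)]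
      exact hlip p hp q hq h
    · rw [dist_eq_norm, Real.dist_eq, abs_of_nonneg (by linarith)]
      exact hlip q hq p hp h
  have hcau : Cauchy (map w (𝓝[<] T)) := by
    exact (cauchy_nhds (a := T)).mono nhdsWithin_le_nhds |>.map_of_le hLip.uniformContinuousOn
      (le_principal_iff.2 (Ico_mem_nhdsLT hs.2))
  exact cauchy_map_iff_exists_tendsto.1 hcau

end ODE

/-! ### The comparison argument for a maximum of finitely many functions -/

section Comparison

open scoped NNReal ENNReal

variable {N : ℕ} {u : Fin N → ℝ → ℝ} {j : ℝ → Fin N} {a b : ℝ}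

/-- A pointwise maximum of finitely many functions of class `C¹`, written `u (j t) t` with an index
`j t` of a maximal term, is Lipschitz on compact intervals. -/
theorem exists_lipschitzOnWith_max {s : Set ℝ} (hab : Icc a b ⊆ s)
    (hu : ∀ i, ContDiffOn ℝ 1 (u i) s) (hj : ∀ t i, u i t ≤ u (j t) t) :
    ∃ K : ℝ≥0, LipschitzOnWith K (fun t => u (j t) t) (Icc a b) := by
  have h1 : ∀ i, ∃ K : ℝ≥0, LipschitzOnWith K (u i) (Icc a b) := fun i =>
    ((hu i).mono hab).exists_lipschitzOnWith one_ne_zero (convex_Icc a b) isCompact_Icc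
  choose K hK using h1
  refine ⟨Finset.univ.sup K, LipschitzOnWith.of_dist_le_mul fun p hp q hq => ?_⟩
  have h2 : ∀ i, dist (u i p) (u i q) ≤ (Finset.univ.sup K : ℝ≥0) * dist p q := fun i =>
    ((hK i).dist_le_mul p hp q hq).trans (mul_le_mul_of_nonneg_right
      (NNReal.coe_le_coe.2 (Finset.le_sup (Finset.mem_univ i))) dist_nonneg)
  have h3 := abs_le.1 (h2 (j p))
  have h4 := abs_le.1 (h2 (j q))
  have h5 := hj p (j q)
  have h6 := hj q (j p)
  rw [Real.dist_eq, abs_le]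
  constructor <;> linarith [h3.2, h4.1]

/-- At a point where the maximum `max_i u_i` is differentiable, its derivative is that of any `u_i`
at which the maximum is attained. -/
theorem deriv_max_eq {t : ℝ} (hj : ∀ t i, u i t ≤ u (j t) t)
    (hd : DifferentiableAt ℝ (fun t => u (j t) t) t) (hu : DifferentiableAt ℝ (u (j t)) t) :
    deriv (fun t => u (j t) t) t = deriv (u (j t)) t := by
  have hmin : IsLocalMin (fun s => u (j s) s - u (j t) s) t := by
    refine Eventually.of_forall fun s => ?_
    have := hj s (j t)
    simp only [sub_self]
    linarith
  have h := hmin.hasDerivAt_eq_zero (hd.hasDerivAt.sub hu.hasDerivAt)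
  linarith

/-- The differential inequality for the maximum `m` holds almost everywhere; as `m` is Lipschitz, it
can be integrated. The number `ε > 0` keeps the integrand `1 / (U + ε)` bounded. -/
theorem integral_inv_le_integral (hab : a ≤ b) {s : Set ℝ} (hs : IsOpen s) (hsub : Icc a b ⊆ s)
    (hu : ∀ i, ContDiffOn ℝ 1 (u i) s) (hj : ∀ t i, u i t ≤ u (j t) t)
    {U : ℝ → ℝ} (hU : Continuous U) (hU0 : ∀ x, 0 ≤ U x)
    {ψ : ℝ → ℝ} (hψ0 : ∀ t ∈ Ioo a b, 0 ≤ ψ t) (hψ : IntervalIntegrable ψ volume a b)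
    (hder : ∀ t ∈ Ioo a b, deriv (u (j t)) t ≤ U (u (j t) t) * ψ t) {ε : ℝ} (hε : 0 < ε) :
    ∫ x in (u (j a) a)..(u (j b) b), (U x + ε)⁻¹ ≤ ∫ t in a..b, ψ t := by
  set m : ℝ → ℝ := fun t => u (j t) t with hm
  obtain ⟨K, hK⟩ := exists_lipschitzOnWith_max hsub hu hj
  have hpos : ∀ x, 0 < U x + ε := fun x => add_pos_of_nonneg_of_pos (hU0 x) hε
  have hc : Continuous fun x => (U x + ε)⁻¹ :=
    (hU.add continuous_const).inv₀ fun x => (hpos x).ne'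
  set Φ : ℝ → ℝ := fun v => ∫ x in (0 : ℝ)..v, (U x + ε)⁻¹ with hΦ
  have hΦd : ∀ v, HasDerivAt Φ (U v + ε)⁻¹ v := fun v =>
    intervalIntegral.integral_hasDerivAt_right (hc.intervalIntegrable _ _)
      hc.aestronglyMeasurable.stronglyMeasurableAtFilter hc.continuousAt
  have hΦlip : LipschitzWith ⟨ε⁻¹, (inv_pos.2 hε).le⟩ Φ := by
    refine lipschitzWith_of_nnnorm_deriv_le (fun v => (hΦd v).differentiableAt) fun v => ?_
    rw [(hΦd v).deriv]
    change ‖(U v + ε)⁻¹‖ ≤ ε⁻¹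
    rw [Real.norm_of_nonneg (inv_pos.2 (hpos v)).le]
    exact inv_anti₀ hε (by linarith [hU0 v])
  have hmac : AbsolutelyContinuousOnInterval m a b :=
    LipschitzOnWith.absolutelyContinuousOnInterval (by rw [uIcc_of_le hab]; exact hK)
  have hgac : AbsolutelyContinuousOnInterval (Φ ∘ m) a b :=
    LipschitzOnWith.absolutelyContinuousOnInterval
      (by rw [uIcc_of_le hab]; exact hΦlip.comp_lipschitzOnWith hK)
  have hle : (fun t => deriv (Φ ∘ m) t) ≤ᵐ[volume.restrict (Icc a b)] ψ := by
    rw [← restrict_Ioo_eq_restrict_Icc]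
    refine (ae_restrict_iff' measurableSet_Ioo).2 ?_
    filter_upwards [hmac.ae_differentiableAt] with t ht htab
    have htm := ht (by rw [uIcc_of_le hab]; exact Ioo_subset_Icc_self htab)
    have hut : DifferentiableAt ℝ (u (j t)) t :=
      ((hu (j t)).differentiableOn one_ne_zero).differentiableAt
        (hs.mem_nhds (hsub (Ioo_subset_Icc_self htab)))
    have h1 : deriv m t ≤ U (m t) * ψ t := by
      rw [deriv_max_eq hj htm hut]
      exact hder t htab
    rw [((hΦd (m t)).comp t htm.hasDerivAt).deriv, inv_mul_le_iff₀ (hpos _)]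
    nlinarith [hψ0 t htab]
  have h1 := hgac.integral_deriv_eq_sub
  have h2 := intervalIntegral.integral_mono_ae_restrict hab hgac.intervalIntegrable_deriv hψ hle
  rw [h1] at h2
  calc ∫ x in (m a)..(m b), (U x + ε)⁻¹ = Φ (m b) - Φ (m a) :=
        (intervalIntegral.integral_interval_sub_left (hc.intervalIntegrable _ _)
          (hc.intervalIntegrable _ _)).symm
    _ ≤ _ := h2

/-- If `∫_{u₀}^b du / (U(u) + ε)` is bounded uniformly in `b` and `ε > 0`, then
`∫_{u₀}^∞ du / U(u)` is finite. -/
theorem lintegral_inv_le_of_forall {U : ℝ → ℝ} (hU : Continuous U) (hU0 : ∀ x, 0 ≤ U x) {u₀ I : ℝ}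
    (h : ∀ b, u₀ ≤ b → ∀ ε : ℝ, 0 < ε → ∫ x in u₀..b, (U x + ε)⁻¹ ≤ I) :
    ∫⁻ x in Ioi u₀, (ENNReal.ofReal (U x))⁻¹ ≤ ENNReal.ofReal I := by
  set ε : ℕ → ℝ := fun k => 1 / ((k : ℝ) + 1) with hε
  have hεpos : ∀ k, 0 < ε k := fun k => by positivity
  have hpos : ∀ k x, 0 < U x + ε k := fun k x => add_pos_of_nonneg_of_pos (hU0 x) (hεpos k)
  have hc : ∀ k, Continuous fun x => (U x + ε k)⁻¹ := fun k =>
    (hU.add continuous_const).inv₀ fun x => (hpos k x).ne'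
  set F : ℕ → ℝ → ℝ≥0∞ := fun k =>
    (Ioc u₀ (u₀ + k)).indicator fun x => ENNReal.ofReal (U x + ε k)⁻¹ with hF
  have hFm : ∀ k, Measurable (F k) := fun k =>
    ((hc k).measurable.ennreal_ofReal).indicator measurableSet_Ioc
  have hFint : ∀ k, ∫⁻ x in Ioi u₀, F k x ≤ ENNReal.ofReal I := by
    intro k
    have hle : u₀ ≤ u₀ + k := by simp
    calc ∫⁻ x in Ioi u₀, F k x ≤ ∫⁻ x, F k x := setLIntegral_le_lintegral _ _
      _ = ∫⁻ x in Ioc u₀ (u₀ + k), ENNReal.ofReal (U x + ε k)⁻¹ :=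
          lintegral_indicator measurableSet_Ioc _
      _ = ENNReal.ofReal (∫ x in Ioc u₀ (u₀ + k), (U x + ε k)⁻¹) :=
          (ofReal_integral_eq_lintegral_ofReal
            (((hc k).intervalIntegrable u₀ (u₀ + k)).1)
            (Eventually.of_forall fun x => (inv_pos.2 (hpos k x)).le)).symm
      _ ≤ ENNReal.ofReal I := by
          refine ENNReal.ofReal_le_ofReal ?_
          rw [← intervalIntegral.integral_of_le hle]
          exact h _ hle _ (hεpos k)
  have hlim : ∀ x ∈ Ioi u₀, Tendsto (fun k => F k x) atTop (𝓝 (ENNReal.ofReal (U x))⁻¹) := by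
    intro x hx
    have h1 : Tendsto (fun k => U x + ε k) atTop (𝓝 (U x)) := by
      simpa [hε] using (tendsto_one_div_add_atTop_nhds_zero_nat (𝕜 := ℝ)).const_add (U x)
    have h2 : Tendsto (fun k => (ENNReal.ofReal (U x + ε k))⁻¹) atTop
        (𝓝 (ENNReal.ofReal (U x))⁻¹) :=
      (continuous_inv.tendsto _).comp ((ENNReal.continuous_ofReal.tendsto _).comp h1)
    refine h2.congr' ?_
    obtain ⟨k₀, hk₀⟩ := exists_nat_ge (x - u₀)
    filter_upwards [eventually_ge_atTop k₀] with k hk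
    have hk' : (k₀ : ℝ) ≤ k := by exact_mod_cast hk
    have hxm : x ∈ Ioc u₀ (u₀ + k) := ⟨hx, by linarith⟩
    rw [hF]
    simp only [indicator_of_mem hxm]
    rw [ENNReal.ofReal_inv_of_pos (hpos k x)]
  calc ∫⁻ x in Ioi u₀, (ENNReal.ofReal (U x))⁻¹
      = ∫⁻ x in Ioi u₀, liminf (fun k => F k x) atTop :=
        setLIntegral_congr_fun measurableSet_Ioi fun x hx => (hlim x hx).liminf_eq.symm
    _ ≤ liminf (fun k => ∫⁻ x in Ioi u₀, F k x) atTop := lintegral_liminf_le hFm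
    _ ≤ liminf (fun _ : ℕ => ENNReal.ofReal I) atTop := liminf_le_liminf
        (Eventually.of_forall hFint)
    _ = ENNReal.ofReal I := liminf_const _

/-- **No blow-up.** If `m = max_i u_i` satisfies `m' ≤ U(m) ψ` with integrable `ψ` and
`∫^∞ du / U(u) = ∞`, then `m` does not tend to infinity in finite time. -/
theorem not_tendsto_max_atTop {T : ℝ} (haT : a < T)
    (hu : ∀ i, ContDiffOn ℝ 1 (u i) (Ioo a T)) (hu0 : ∀ i t, 0 ≤ u i t)
    (hj : ∀ t i, u i t ≤ u (j t) t)
    {U : ℝ → ℝ} (hU : ContinuousOn U (Ici 0)) (hU0 : ∀ x, 0 ≤ x → 0 ≤ U x)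
    (hUint : ∀ u₀ : ℝ, 0 < u₀ → ∫⁻ x in Ioi u₀, (ENNReal.ofReal (U x))⁻¹ = ⊤)
    {ψ : ℝ → ℝ} (hψ0 : ∀ t ∈ Ioo a T, 0 ≤ ψ t) (hψ : IntegrableOn ψ (Ioo a T))
    (hder : ∀ t ∈ Ioo a T, deriv (u (j t)) t ≤ U (u (j t) t) * ψ t) :
    ¬ Tendsto (fun t => u (j t) t) (𝓝[<] T) atTop := by
  intro htop
  set U' : ℝ → ℝ := fun x => U (max x 0) with hU'
  have hU'c : Continuous U' :=
    hU.comp_continuous (continuous_id.max continuous_const) fun x => mem_Ici.2 (le_max_right _ _)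
  have hU'0 : ∀ x, 0 ≤ U' x := fun x => hU0 _ (le_max_right _ _)
  have hU'eq : ∀ x, 0 ≤ x → U' x = U x := fun x hx => by rw [hU']; simp only [max_eq_left hx]
  obtain ⟨s, has, hsT⟩ := exists_between haT
  set u₀ := u (j s) s + 1 with hu₀
  have hu₀pos : 0 < u₀ := by linarith [hu0 (j s) s]
  have hbound : ∀ b, u₀ ≤ b → ∀ ε : ℝ, 0 < ε →
      ∫ x in u₀..b, (U' x + ε)⁻¹ ≤ ∫ t in Ioo a T, ψ t := by
    intro b hb ε hε
    have hpos : ∀ x, 0 < U' x + ε := fun x => add_pos_of_nonneg_of_pos (hU'0 x) hε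
    have hc : Continuous fun x => (U' x + ε)⁻¹ :=
      (hU'c.add continuous_const).inv₀ fun x => (hpos x).ne'
    obtain ⟨t, htb, hst, htT⟩ := ((htop.eventually_ge_atTop b).and (Ioo_mem_nhdsLT hsT)).exists
    have hsub : Ioc s t ⊆ Ioo a T := fun τ hτ => ⟨has.trans hτ.1, hτ.2.trans_lt htT⟩
    have h1 := integral_inv_le_integral (ψ := ψ) hst.le isOpen_Ioo
      (fun τ hτ => ⟨has.trans_le hτ.1, hτ.2.trans_lt htT⟩) hu hj hU'c hU'0
      (fun τ hτ => hψ0 τ (hsub (Ioo_subset_Ioc_self hτ)))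
      ((intervalIntegrable_iff_integrableOn_Ioc_of_le hst.le).2 (hψ.mono_set hsub))
      (fun τ hτ => by
        rw [hU'eq _ (hu0 _ _)]
        exact hder τ (hsub (Ioo_subset_Ioc_self hτ))) hε
    calc ∫ x in u₀..b, (U' x + ε)⁻¹ ≤ ∫ x in (u (j s) s)..(u (j t) t), (U' x + ε)⁻¹ :=
          intervalIntegral.integral_mono_interval (by linarith) hb htb
            (Eventually.of_forall fun x => (inv_pos.2 (hpos x)).le) (hc.intervalIntegrable _ _)
      _ ≤ ∫ τ in s..t, ψ τ := h1
      _ = ∫ τ in Ioc s t, ψ τ := intervalIntegral.integral_of_le hst.le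
      _ ≤ ∫ τ in Ioo a T, ψ τ := setIntegral_mono_set hψ
          ((ae_restrict_iff' measurableSet_Ioo).2 (Eventually.of_forall hψ0))
          (Eventually.of_forall hsub)
  have h1 := lintegral_inv_le_of_forall hU'c hU'0 hbound
  have h2 : ∫⁻ x in Ioi u₀, (ENNReal.ofReal (U' x))⁻¹ = ⊤ := by
    rw [← hUint u₀ hu₀pos]
    refine setLIntegral_congr_fun measurableSet_Ioi fun x hx => ?_
    simp only [hU'eq x (hu₀pos.trans hx).le]
  rw [h2] at h1
  exact absurd h1 (not_le.2 ENNReal.ofReal_lt_top)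

end Comparison

/-! ### Locally Lipschitz maps depending on time -/

section LocallyLipschitz

variable {E F H : Type*} [NormedAddCommGroup E] [NormedAddCommGroup F] [NormedAddCommGroup H]

theorem IsLocallyLipschitz.of_lipschitzWith {K : NNReal} {g : E → F} (hg : LipschitzWith K g) :
    IsLocallyLipschitz fun _ x => g x :=
  fun _ _ => ⟨1, one_pos, K, K.coe_nonneg, fun _ _ x y _ _ => hg.norm_sub_le x y⟩

theorem IsLocallyLipschitz.sub {g h : ℝ → E → F} (hg : IsLocallyLipschitz g)
    (hh : IsLocallyLipschitz h) : IsLocallyLipschitz fun t x => g t x - h t x := by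
  intro t' x'
  obtain ⟨r, hr, L, hL, H⟩ := hg t' x'
  obtain ⟨s, hs, M, hM, H'⟩ := hh t' x'
  refine ⟨min r s, lt_min hr hs, L + M, add_nonneg hL hM, fun t ht x y hx hy => ?_⟩
  rw [lt_min_iff] at ht hx hy
  calc ‖g t x - h t x - (g t y - h t y)‖ = ‖(g t x - g t y) - (h t x - h t y)‖ := by
        congr 1; abel
    _ ≤ ‖g t x - g t y‖ + ‖h t x - h t y‖ := norm_sub_le _ _
    _ ≤ L * ‖x - y‖ + M * ‖x - y‖ := add_le_add (H t ht.1 x y hx.1 hy.1) (H' t ht.2 x y hx.2 hy.2)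
    _ = _ := by ring

theorem IsLocallyLipschitz.comp {g : ℝ → F → H} {h : ℝ → E → F} (hg : IsLocallyLipschitz g)
    (hh : IsLocallyLipschitz h) (hc : Continuous fun p : ℝ × E => h p.1 p.2) :
    IsLocallyLipschitz fun t x => g t (h t x) := by
  intro t' x'
  obtain ⟨r, hr, L, hL, hgr⟩ := hg t' (h t' x')
  obtain ⟨s, hs, M, hM, hhs⟩ := hh t' x'
  obtain ⟨δ, hδ, hδh⟩ := Metric.continuousAt_iff.1 (hc.continuousAt (x := (t', x'))) r hr
  have hnear : ∀ t x, |t - t'| < δ → ‖x - x'‖ < δ → ‖h t x - h t' x'‖ < r := by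
    intro t x ht hx
    rw [← dist_eq_norm]
    refine hδh (x := (t, x)) ?_
    rw [Prod.dist_eq, Real.dist_eq, dist_eq_norm]
    exact max_lt ht hx
  refine ⟨min r (min s δ), lt_min hr (lt_min hs hδ), L * M, mul_nonneg hL hM,
    fun t ht x y hx hy => ?_⟩
  simp only [lt_min_iff] at ht hx hy
  calc ‖g t (h t x) - g t (h t y)‖ ≤ L * ‖h t x - h t y‖ :=
        hgr t ht.1 _ _ (hnear t x ht.2.2 hx.2.2) (hnear t y ht.2.2 hy.2.2)
    _ ≤ L * (M * ‖x - y‖) :=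
        mul_le_mul_of_nonneg_left (hhs t ht.2.1 x y hx.2.1 hy.2.1) hL
    _ = _ := by ring

theorem IsLocallyLipschitz.prodMk_right {g : ℝ → E → F} (hg : IsLocallyLipschitz g) :
    IsLocallyLipschitz fun t x => (x, g t x) := by
  intro t' x'
  obtain ⟨r, hr, L, hL, H⟩ := hg t' x'
  refine ⟨r, hr, 1 + L, by positivity, fun t ht x y hx hy => ?_⟩
  rw [Prod.mk_sub_mk, Prod.norm_mk]
  have h1 : 0 ≤ L * ‖x - y‖ := by positivity
  refine max_le ?_ ((H t ht x y hx hy).trans ?_) <;> nlinarith [norm_nonneg (x - y)]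

end LocallyLipschitz

/-! ### Regularity of implicit functions that are known to exist globally -/

section ImplicitFunction

variable {𝕜 M Z Y₂ : Type*} [RCLike 𝕜] [NormedAddCommGroup M]
  [NormedAddCommGroup Z] [NormedSpace 𝕜 Z]
  [NormedAddCommGroup Y₂] [NormedSpace 𝕜 Y₂]

/-- Near `(t', w', η(t', w'))` the map `F` is approximated in its last variable by an isomorphism
`Λ`, up to a Lipschitz error whose constant is less than `‖Λ⁻¹‖⁻¹`. -/
def IsNearIsomorphism (𝕜 : Type*) {M Z Y₂ : Type*} [RCLike 𝕜] [NormedAddCommGroup M]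
    [NormedAddCommGroup Z] [NormedSpace 𝕜 Z] [NormedAddCommGroup Y₂] [NormedSpace 𝕜 Y₂]
    (F : ℝ → M → Z → Y₂) (η : ℝ → M → Z) (t' : ℝ) (w' : M) : Prop :=
  ∃ Λ : Z ≃L[𝕜] Y₂, ∃ r : ℝ, 0 < r ∧ ∃ c : ℝ, c * ‖(Λ.symm : Y₂ →L[𝕜] Z)‖ < 1 ∧
    ∀ t, |t - t'| < r → ∀ w, ‖w - w'‖ < r → ∀ y z,
      ‖y - η t' w'‖ < r → ‖z - η t' w'‖ < r →
        ‖F t w y - F t w z - Λ (y - z)‖ ≤ c * ‖y - z‖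

/-- The Newton-like map `z ↦ z - Λ⁻¹ F(t, w, z)` is a contraction with constant `θ` near
`η(t', w')`, and its fixed points are the zeros of `F(t, w, ·)`. -/
theorem exists_uniform_contraction {F : ℝ → M → Z → Y₂} {η : ℝ → M → Z} {t' : ℝ} {w' : M}
    (hloc : IsNearIsomorphism 𝕜 F η t' w') :
    ∃ Λ : Z ≃L[𝕜] Y₂, ∃ r : ℝ, 0 < r ∧ ∃ θ : ℝ, 0 ≤ θ ∧ θ < 1 ∧
      ∀ t, |t - t'| < r → ∀ w, ‖w - w'‖ < r → ∀ y z,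
        ‖y - η t' w'‖ < r → ‖z - η t' w'‖ < r →
          ‖(y - Λ.symm (F t w y)) - (z - Λ.symm (F t w z))‖ ≤ θ * ‖y - z‖ := by
  obtain ⟨Λ, r, hr, c, hc, H⟩ := hloc
  refine ⟨Λ, r, hr, max 0 (c * ‖(Λ.symm : Y₂ →L[𝕜] Z)‖), le_max_left _ _, max_lt one_pos hc,
    fun t ht w hw y z hy hz => ?_⟩
  have h1 : (y - Λ.symm (F t w y)) - (z - Λ.symm (F t w z)) =
      -((Λ.symm : Y₂ →L[𝕜] Z) (F t w y - F t w z - Λ (y - z))) := by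
    simp only [map_sub, ContinuousLinearEquiv.coe_coe, ContinuousLinearEquiv.symm_apply_apply]
    abel
  rw [h1, norm_neg]
  calc _ ≤ ‖(Λ.symm : Y₂ →L[𝕜] Z)‖ * ‖F t w y - F t w z - Λ (y - z)‖ :=
        ContinuousLinearMap.le_opNorm _ _
    _ ≤ ‖(Λ.symm : Y₂ →L[𝕜] Z)‖ * (c * ‖y - z‖) :=
        mul_le_mul_of_nonneg_left (H t ht w hw y z hy hz) (norm_nonneg _)
    _ = c * ‖(Λ.symm : Y₂ →L[𝕜] Z)‖ * ‖y - z‖ := by ring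
    _ ≤ _ := mul_le_mul_of_nonneg_right (le_max_right _ _) (norm_nonneg _)

variable {F : ℝ → M → Z → Y₂} {η : ℝ → M → Z} [CompleteSpace Z]

/-- The unique zero `z = η(t, w)` of `F(t, w, ·)` depends continuously on `(t, w)`: a contraction
finds a zero near `η(t', w')`, and by uniqueness it is `η(t, w)`. -/
theorem continuous_of_unique_zero
    (hη : ∀ t w z, F t w z = 0 ↔ z = η t w) (hloc : ∀ t w, IsNearIsomorphism 𝕜 F η t w)
    (hF : Continuous fun p : ℝ × M × Z => F p.1 p.2.1 p.2.2) :
    Continuous fun p : ℝ × M => η p.1 p.2 := by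
  rw [continuous_iff_continuousAt]
  rintro ⟨t', w'⟩
  obtain ⟨Λ, r, hr, θ, hθ0, hθ1, H⟩ := exists_uniform_contraction (hloc t' w')
  rw [Metric.continuousAt_iff]
  intro ε hε
  set ρ := min (ε / 2) (r / 2) with hρ
  have hρpos : 0 < ρ := by positivity
  have hρε : ρ < ε := lt_of_le_of_lt (min_le_left _ _) (by linarith)
  have hρr : ρ < r := lt_of_le_of_lt (min_le_right _ _) (by linarith)
  have hcont : Continuous fun p : ℝ × M => Λ.symm (F p.1 p.2 (η t' w')) :=
    Λ.symm.continuous.comp 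
      (hF.comp (continuous_fst.prodMk (continuous_snd.prodMk continuous_const)))
  have hθ1' : 0 < 1 - θ := by linarith
  obtain ⟨δ, hδ, hδF⟩ := Metric.continuousAt_iff.1 (hcont.continuousAt (x := (t', w')))
    ((1 - θ) * ρ) (by positivity)
  have hzero : F t' w' (η t' w') = 0 := (hη t' w' _).2 rfl
  refine ⟨min δ r, lt_min hδ hr, ?_⟩
  rintro ⟨t, w⟩ hp
  have hpδ := hδF (hp.trans_le (min_le_left _ _))
  simp only [hzero, map_zero, dist_zero_right] at hpδ
  have hpr := hp.trans_le (min_le_right _ _)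
  rw [Prod.dist_eq, max_lt_iff] at hpr
  have htr : |t - t'| < r := hpr.1
  have hwr : ‖w - w'‖ < r := by rw [← dist_eq_norm]; exact hpr.2
  have hball : ∀ z ∈ Metric.closedBall (η t' w') ρ, ‖z - η t' w'‖ < r := fun z hz => by
    rw [← dist_eq_norm]; exact lt_of_le_of_lt hz hρr
  set Ψ : Z → Z := fun z => z - Λ.symm (F t w z) with hΨ
  have hmaps : MapsTo Ψ (Metric.closedBall (η t' w') ρ) (Metric.closedBall (η t' w') ρ) := by
    intro z hz
    have h1 := H t htr w hwr z (η t' w') (hball z hz) (by simpa using hr)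
    rw [Metric.mem_closedBall, dist_eq_norm] at hz ⊢
    calc ‖Ψ z - η t' w'‖ = ‖(Ψ z - Ψ (η t' w')) - Λ.symm (F t w (η t' w'))‖ := by
          congr 1; simp only [hΨ]; abel
      _ ≤ ‖Ψ z - Ψ (η t' w')‖ + ‖Λ.symm (F t w (η t' w'))‖ := norm_sub_le _ _
      _ ≤ θ * ‖z - η t' w'‖ + (1 - θ) * ρ := add_le_add h1 hpδ.le
      _ ≤ θ * ρ + (1 - θ) * ρ := by gcongr
      _ = ρ := by ring
  have hcontr : ContractingWith ⟨θ, hθ0⟩ (hmaps.restrict Ψ _ _) := by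
    refine ⟨hθ1, LipschitzWith.of_dist_le_mul fun y z => ?_⟩
    rw [Subtype.dist_eq, Subtype.dist_eq, dist_eq_norm, dist_eq_norm]
    exact H t htr w hwr y z (hball y y.2) (hball z z.2)
  obtain ⟨z, hz, hfix, -⟩ := hcontr.exists_fixedPoint' Metric.isClosed_closedBall.isComplete hmaps
    (Metric.mem_closedBall_self hρpos.le) (edist_ne_top _ _)
  have hFz : F t w z = 0 := by
    have h1 : z - Λ.symm (F t w z) = z := hfix
    have h2 : Λ.symm (F t w z) = 0 := by simpa using h1
    simpa using h2
  have hzη : z = η t w := (hη t w z).1 hFz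
  rw [hzη] at hz
  exact lt_of_le_of_lt hz hρε

/-- The unique zero is locally Lipschitz in `w`: the contraction estimate controls
`η(t, w) - η(t, v)` by the Lipschitz dependence of `F` on `w`. -/
theorem isLocallyLipschitz_of_unique_zero
    (hη : ∀ t w z, F t w z = 0 ↔ z = η t w) (hloc : ∀ t w, IsNearIsomorphism 𝕜 F η t w)
    (hF : Continuous fun p : ℝ × M × Z => F p.1 p.2.1 p.2.2)
    (hFL : IsLocallyLipschitz fun t (p : M × Z) => F t p.1 p.2) : IsLocallyLipschitz η := by
  intro t' w'
  obtain ⟨Λ, r, hr, θ, hθ0, hθ1, H⟩ := exists_uniform_contraction (hloc t' w')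
  obtain ⟨s, hs, L, hL, HL⟩ := hFL t' (w', η t' w')
  obtain ⟨δ, hδ, hδη⟩ := Metric.continuousAt_iff.1
    ((continuous_of_unique_zero hη hloc hF).continuousAt (x := (t', w'))) (min r s) (lt_min hr hs)
  have hθ1' : 0 < 1 - θ := by linarith
  have hnear : ∀ t w, |t - t'| < δ → ‖w - w'‖ < δ → ‖η t w - η t' w'‖ < min r s := by
    intro t w ht hw
    rw [← dist_eq_norm]
    refine hδη (x := (t, w)) ?_
    rw [Prod.dist_eq, Real.dist_eq, dist_eq_norm]
    exact max_lt ht hw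
  set N := ‖(Λ.symm : Y₂ →L[𝕜] Z)‖ with hN
  refine ⟨min δ (min r s), lt_min hδ (lt_min hr hs), (1 - θ)⁻¹ * (N * L),
    by positivity, fun t ht w v hw hv => ?_⟩
  rw [lt_min_iff] at ht hw hv
  have hηw := hnear t w ht.1 hw.1
  have hηv := hnear t v ht.1 hv.1
  rw [lt_min_iff] at ht hw hv hηw hηv
  have h1 := H t ht.2.1 w hw.2.1 (η t w) (η t v) hηw.1 hηv.1
  have h2 : F t w (η t w) = 0 := (hη t w _).2 rfl
  have h3 : F t v (η t v) = 0 := (hη t v _).2 rfl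
  have h4 := HL t ht.2.2 (w, η t v) (v, η t v)
    (by rw [Prod.mk_sub_mk, Prod.norm_mk]; exact max_lt hw.2.2 hηv.2)
    (by rw [Prod.mk_sub_mk, Prod.norm_mk]; exact max_lt hv.2.2 hηv.2)
  simp only [h3, sub_zero, Prod.mk_sub_mk, sub_self, Prod.norm_mk, norm_zero] at h4
  rw [max_eq_left (norm_nonneg _)] at h4
  have h5 : ‖Λ.symm (F t w (η t v))‖ ≤ N * (L * ‖w - v‖) :=
    ((Λ.symm : Y₂ →L[𝕜] Z).le_opNorm _).trans (mul_le_mul_of_nonneg_left h4 (norm_nonneg _))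
  rw [h2, map_zero, sub_zero] at h1
  have h6 : ‖η t w - η t v‖ ≤ θ * ‖η t w - η t v‖ + N * (L * ‖w - v‖) := by
    calc ‖η t w - η t v‖ = ‖(η t w - (η t v - Λ.symm (F t w (η t v)))) -
          Λ.symm (F t w (η t v))‖ := by congr 1; abel
      _ ≤ _ := norm_sub_le _ _
      _ ≤ _ := add_le_add h1 h5
  rw [mul_assoc, le_inv_mul_iff₀ hθ1']
  linarith

end ImplicitFunction

namespace CanonicalSystem

variable {𝕜 D Y : Type*} [RCLike 𝕜] [NormedAddCommGroup D] [NormedSpace 𝕜 D]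
  [NormedAddCommGroup Y] [NormedSpace 𝕜 Y] {A B : D →ₗ[𝕜] Y} {ν n : ℕ}
  {S : CanonicalSystem A B ν n}

/-! ### The inverse of `Ã` and the algebraic part of the system -/

theorem IsTame.Atilde_AtildeInv (hT : S.IsTame) (y : Y) : S.Atilde (S.AtildeInv y) = y :=
  Function.rightInverse_invFun hT.bijective.2 y

theorem IsTame.AtildeInv_Atilde (hT : S.IsTame) (x : D) : S.AtildeInv (S.Atilde x) = x :=
  Function.leftInverse_invFun hT.bijective.1 x

/-- `Ã⁻¹` as a linear map. -/
def IsTame.invLinear (hT : S.IsTame) : Y →ₗ[𝕜] D where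
  toFun := S.AtildeInv
  map_add' x y := hT.bijective.1 (by simp only [map_add, hT.Atilde_AtildeInv])
  map_smul' c x := hT.bijective.1 (by simp only [map_smul, hT.Atilde_AtildeInv, RingHom.id_apply])

/-- `Ã⁻¹` as a bounded operator. -/
def IsTame.inv (hT : S.IsTame) : Y →L[𝕜] D :=
  hT.invLinear.mkContinuousOfExistsBound (by
    obtain ⟨C, -, hC⟩ := hT.exists_bound
    refine ⟨C, fun y => ?_⟩
    have := (hC (S.AtildeInv y)).1
    rwa [hT.Atilde_AtildeInv] at this)

/-- The bounded operator `B Ã⁻¹`. -/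
def IsTame.invB (hT : S.IsTame) : Y →L[𝕜] Y :=
  (B ∘ₗ hT.invLinear).mkContinuousOfExistsBound (by
    obtain ⟨C, -, hC⟩ := hT.exists_bound
    refine ⟨C, fun y => ?_⟩
    have := (hC (S.AtildeInv y)).2
    rwa [hT.Atilde_AtildeInv] at this)

/-- The restriction of `B` to `D₂₀ = ker A`, a bounded operator. -/
def IsTame.BKer (hT : S.IsTame) : S.D20 →L[𝕜] Y :=
  (B ∘ₗ S.D20.subtype).mkContinuousOfExistsBound (by
    obtain ⟨C, -, hC⟩ := hT.exists_bound_B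
    refine ⟨C, fun d => ?_⟩
    have h := hC d
    have hd : A d = 0 := d.2
    rwa [hd, norm_zero, add_zero] at h)

theorem IsTame.inv_apply (hT : S.IsTame) (y : Y) : hT.inv y = S.AtildeInv y := rfl

theorem IsTame.invB_apply (hT : S.IsTame) (y : Y) : hT.invB y = B (hT.inv y) := rfl

theorem IsTame.BKer_apply (hT : S.IsTame) (d : S.D20) : hT.BKer d = B d := rfl

theorem IsTame.P20_inv (hT : S.IsTame) (w : S.W) : S.P20 (hT.inv w) = 0 :=
  S.P20_eq_zero_of_Atilde_mem (by rw [hT.inv_apply, hT.Atilde_AtildeInv]; exact w.2)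

theorem IsTame.A_inv (hT : S.IsTame) (w : S.W) : A (hT.inv w) = w := by
  rw [← S.Atilde_eq_A (hT.P20_inv w), hT.inv_apply, hT.Atilde_AtildeInv]

theorem IsTame.inv_A (hT : S.IsTame) (x : D) : hT.inv (A x) = x - S.P20 x := by
  have h : S.Atilde (x - S.P20 x) = A x := by
    rw [S.Atilde_eq_A (by rw [map_sub, P20_P20, sub_self]), map_sub, A_P20, sub_zero]
  rw [← h, hT.inv_apply, hT.AtildeInv_Atilde]

theorem P20_add {u : D} (hu : S.P20 u = 0) (d : S.D20) : S.P20 (u + d) = d := by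
  rw [map_add, hu, S.P20_of_mem d.2, zero_add]

theorem P1_add (u : D) (d : S.D20) : S.P1 (u + d) = S.P1 u := by
  rw [map_add, S.P1_of_mem d.2, add_zero]

theorem P2Sigma_add (u : D) (d : S.D20) : S.P2Sigma (u + d) = S.P2Sigma u := by
  rw [map_add, S.P2Sigma_of_mem d.2, add_zero]

theorem P1_add_P2Sigma {u : D} (hu : S.P20 u = 0) : S.P1 u + S.P2Sigma u = u := by
  rw [P1_apply, hu]; abel

/-- `F₂*` is the residual of the algebraic equation that defines `L₀`. -/
theorem coe_F2star {u : D} (hu : S.P20 u = 0) (f : ℝ → D → Y) (t : ℝ) (d : D) :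
    (S.F2star f t (S.P1 u) (S.P2Sigma u) d : Y) = S.Q2star (f t (u + d) - B (u + d)) := by
  have h1 : S.Q2star (B (S.P2Sigma u)) = S.Q2star (B u) := by
    conv_rhs => rw [← P1_add_P2Sigma hu, map_add, map_add, Q2star_B_P1, zero_add]
  simp only [F2star, P1_add_P2Sigma hu, map_add, map_sub, h1]
  abel

theorem finiteDimensional_D20 (S : CanonicalSystem A B ν n) : FiniteDimensional 𝕜 S.D20 := by
  rw [D20, ← S.span_eigenvectors]
  exact FiniteDimensional.span_of_finite 𝕜 (Set.finite_range _)

theorem completeSpace_W [CompleteSpace Y] (S : CanonicalSystem A B ν n) : CompleteSpace S.W := by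
  have h : IsClosed (S.W : Set Y) := by
    have : (S.W : Set Y) = S.Q2star ⁻¹' {0} := by
      ext y
      exact S.mem_W_iff y
    rw [this]
    exact isClosed_singleton.preimage S.Q2star.continuous
  exact h.completeSpace_coe

variable {f : ℝ → D → Y}

/-- The algebraic part `x₂₀ = η(t, w)` of a consistent point with `A x = w`. For `t < 0`, where no
condition is imposed, the value at `t = 0` is used. -/
def algPart (hT : S.IsTame) (h : S.UniqueAlgebraicPart f) (t : ℝ) (w : S.W) : S.D20 :=
  ⟨(h (max t 0) (le_max_right _ _) (hT.inv w) (S.mem_D1_sup_D2Sigma (hT.P20_inv w))).choose,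
    (h (max t 0) (le_max_right _ _) (hT.inv w)
      (S.mem_D1_sup_D2Sigma (hT.P20_inv w))).choose_spec.1.1⟩

theorem mem_L0_iff (hT : S.IsTame) (h : S.UniqueAlgebraicPart f) (t : ℝ) (w : S.W) (d : S.D20) :
    (max t 0, hT.inv w + d) ∈ S.L0 f ↔ d = algPart hT h t w := by
  have hs := (h (max t 0) (le_max_right _ _) (hT.inv w)
    (S.mem_D1_sup_D2Sigma (hT.P20_inv w))).choose_spec
  constructor
  · intro hd
    exact Subtype.ext (hs.2 d ⟨d.2, hd⟩)
  · rintro rfl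
    exact hs.1.2

/-- The residual `F₂*` as a function of `t`, `w = A x` and `x₂₀`. -/
def residual (hT : S.IsTame) (f : ℝ → D → Y) (t : ℝ) (w : S.W) (d : S.D20) : S.Y2star :=
  S.F2star f (max t 0) (S.P1 (hT.inv w)) (S.P2Sigma (hT.inv w)) d

theorem coe_residual (hT : S.IsTame) (f : ℝ → D → Y) (t : ℝ) (w : S.W) (d : S.D20) :
    (residual hT f t w d : Y) =
      S.Q2star (f (max t 0) (hT.inv w + d)) - S.Q2star (hT.invB w + hT.BKer d) := by
  rw [residual, coe_F2star (hT.P20_inv w), hT.invB_apply, hT.BKer_apply, ← map_add, ← map_sub]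

theorem residual_eq_zero_iff (hT : S.IsTame) (h : S.UniqueAlgebraicPart f) (t : ℝ) (w : S.W)
    (d : S.D20) : residual hT f t w d = 0 ↔ d = algPart hT h t w := by
  rw [← mem_L0_iff hT h, ← Subtype.coe_inj, residual, coe_F2star (hT.P20_inv w)]
  simp [L0]

/-! ### Local conditions on the right-hand side -/

/-- The common consequence of both local conditions: near a consistent point `F₂*` differs from
the isomorphism `Λ` by a Lipschitz error with a fixed constant less than `‖Λ⁻¹‖⁻¹`. -/
def IsNearIso (S : CanonicalSystem A B ν n) (f : ℝ → D → Y) (t' : ℝ) (x' : D) : Prop :=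
  ∃ Λ : S.D20 ≃L[𝕜] S.Y2star, ∃ r : ℝ, 0 < r ∧ ∃ c : ℝ,
    c * ‖(Λ.symm : S.Y2star →L[𝕜] S.D20)‖ < 1 ∧
    ∀ t : ℝ, 0 ≤ t → |t - t'| < r →
    ∀ x1 ∈ S.D1, ‖x1 - S.P1 x'‖ < r →
    ∀ x2S ∈ S.D2Sigma, ‖x2S - S.P2Sigma x'‖ < r →
    ∀ y z : S.D20, ‖(y : D) - S.P20 x'‖ < r → ‖(z : D) - S.P20 x'‖ < r →
      ‖S.F2star f t x1 x2S y - S.F2star f t x1 x2S z - Λ (y - z)‖ ≤ c * ‖y - z‖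

/-- `f` is locally Lipschitz in `x` on `ℝ₊ × D`. -/
def IsLipschitzOnNonneg (f : ℝ → D → Y) : Prop :=
  ∀ t' : ℝ, 0 ≤ t' → ∀ x' : D, ∃ r : ℝ, 0 < r ∧ ∃ L : ℝ, 0 ≤ L ∧
    ∀ t : ℝ, 0 ≤ t → |t - t'| < r → ∀ x y : D, ‖x - x'‖ < r → ‖y - x'‖ < r →
      ‖f t x - f t y‖ ≤ L * ‖x - y‖

variable {Wop : ℝ → D → (S.D20 ≃L[𝕜] S.Y2star)}

theorem LipschitzCondition.isNearIso (h : S.LipschitzCondition f Wop) {t' : ℝ} {x' : D}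
    (hx : (t', x') ∈ S.L0 f) : S.IsNearIso f t' x' := by
  obtain ⟨δ₀, hδ₀, ε₀, hε₀, κ, l, hκ, hl, H⟩ := h.2 t' x' hx
  set N := ‖((Wop t' x').symm : S.Y2star →L[𝕜] S.D20)‖ with hN
  have hNnn : 0 ≤ N := norm_nonneg _
  -- a constant between the limit of `κ` and `‖W⁻¹‖⁻¹`
  obtain ⟨c, hlc, hcN⟩ : ∃ c, l < c ∧ c * N < 1 := by
    refine ⟨l + (1 - l * N) / (2 * (N + 1)), ?_, ?_⟩
    · have : 0 < (1 - l * N) / (2 * (N + 1)) := div_pos (by linarith) (by positivity)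
      linarith
    · have h1 : (1 - l * N) / (2 * (N + 1)) * N ≤ (1 - l * N) / 2 := by
        rw [div_mul_eq_mul_div, div_le_div_iff₀ (by positivity) two_pos]
        nlinarith
      rw [add_mul]
      linarith
  obtain ⟨⟨δ, ε⟩, hκc, hδ, hε⟩ := ((hκ.eventually_lt_const hlc).and
    (prod_mem_prod (Ioc_mem_nhdsGT hδ₀) (Ioc_mem_nhdsGT hε₀))).exists
  simp only at hκc hδ hε
  refine ⟨Wop t' x', min δ ε, lt_min hδ.1 hε.1, c, hcN, ?_⟩
  intro t ht htt x1 hx1 hx1' x2 hx2 hx2' y z hy hz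
  exact (H δ hδ ε hε t ht (htt.trans_le (min_le_left _ _)) x1 hx1 (hx1'.trans_le (min_le_left _ _))
    x2 hx2 (hx2'.trans_le (min_le_left _ _)) y z (hy.trans_le (min_le_right _ _))
    (hz.trans_le (min_le_right _ _))).trans (mul_le_mul_of_nonneg_right hκc.le (norm_nonneg _))

/-- A Fréchet derivative in `x` that is continuous in `(t, x)` approximates increments of `f` in
`x` uniformly near a point. -/
theorem exists_norm_sub_sub_le {f' : ℝ → D → (D →L[𝕜] Y)}
    (hf' : ∀ t : ℝ, 0 ≤ t → ∀ x : D, HasFDerivAt (f t) (f' t x) x)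
    (hc : ContinuousOn (fun p : ℝ × D => f' p.1 p.2) (Set.Ici 0 ×ˢ Set.univ)) {t' : ℝ}
    (ht' : 0 ≤ t') (x' : D) {e : ℝ} (he : 0 < e) :
    ∃ r : ℝ, 0 < r ∧ ∀ t : ℝ, 0 ≤ t → |t - t'| < r → ∀ x y : D, ‖x - x'‖ < r → ‖y - x'‖ < r →
      ‖f t x - f t y - f' t' x' (x - y)‖ ≤ e * ‖x - y‖ := by
  let _ : NormedSpace ℝ D := NormedSpace.restrictScalars ℝ 𝕜 D
  obtain ⟨r, hr, H⟩ := Metric.continuousWithinAt_iff.1 (hc (t', x') ⟨ht', mem_univ _⟩) e he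
  refine ⟨r, hr, fun t ht htt x y hx hy => ?_⟩
  refine Convex.norm_image_sub_le_of_norm_hasFDerivWithin_le' (𝕜 := 𝕜) (f' := f' t)
    (s := Metric.ball x' r) (fun z _ => (hf' t ht z).hasFDerivWithinAt) (fun z hz => ?_)
    (convex_ball x' r) (by rwa [Metric.mem_ball, dist_eq_norm])
    (by rwa [Metric.mem_ball, dist_eq_norm])
  rw [← dist_eq_norm]
  refine (H (x := (t, z)) ⟨ht, mem_univ _⟩ ?_).le
  rw [Prod.dist_eq, Real.dist_eq]
  exact max_lt htt hz

theorem SmoothCondition.isLipschitzOnNonneg (h : S.SmoothCondition f Wop) :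
    IsLipschitzOnNonneg f := by
  obtain ⟨f', hf', hc, -⟩ := h
  intro t' ht' x'
  obtain ⟨r, hr, H⟩ := exists_norm_sub_sub_le hf' hc ht' x' one_pos
  refine ⟨r, hr, 1 + ‖f' t' x'‖, by positivity, fun t ht htt x y hx hy => ?_⟩
  calc ‖f t x - f t y‖ = ‖(f t x - f t y - f' t' x' (x - y)) + f' t' x' (x - y)‖ := by
        congr 1; abel
    _ ≤ _ := norm_add_le _ _
    _ ≤ 1 * ‖x - y‖ + ‖f' t' x'‖ * ‖x - y‖ :=
        add_le_add (H t ht htt x y hx hy) (ContinuousLinearMap.le_opNorm _ _)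
    _ = _ := by ring

theorem SmoothCondition.isNearIso (h : S.SmoothCondition f Wop) {t' : ℝ} {x' : D}
    (hx : (t', x') ∈ S.L0 f) : S.IsNearIso f t' x' := by
  obtain ⟨f', hf', hc, hW⟩ := h
  set N := ‖((Wop t' x').symm : S.Y2star →L[𝕜] S.D20)‖ with hN
  have hNnn : 0 ≤ N := norm_nonneg _
  set q := ‖S.Q2star‖ with hq
  have hqnn : 0 ≤ q := norm_nonneg _
  set e : ℝ := 1 / (2 * (q + 1) * (N + 1)) with he
  have hepos : 0 < e := by positivity
  obtain ⟨r, hr, H⟩ := exists_norm_sub_sub_le hf' hc hx.1 x' hepos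
  refine ⟨Wop t' x', r / 3, by positivity, q * e, ?_, ?_⟩
  · have : q * e * N = (q * N) / (2 * (q + 1) * (N + 1)) := by rw [he]; ring
    rw [this, div_lt_one (by positivity)]
    nlinarith [mul_nonneg hqnn hNnn]
  · intro t ht htt x1 _ hx1' x2 _ hx2' y z hy hz
    have hx' : x' = S.P1 x' + S.P2Sigma x' + S.P20 x' := by rw [P1_apply]; abel
    have hnear : ∀ y : S.D20, ‖(y : D) - S.P20 x'‖ < r / 3 → ‖x1 + x2 + y - x'‖ < r := by
      intro y hy
      have h1 : x1 + x2 + y - x' =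
          (x1 - S.P1 x') + (x2 - S.P2Sigma x') + ((y : D) - S.P20 x') := by
        conv_lhs => rw [hx']
        abel
      rw [h1]
      have := norm_add₃_le (a := x1 - S.P1 x') (b := x2 - S.P2Sigma x') (c := (y : D) - S.P20 x')
      linarith
    have h2 := H t ht (htt.trans (by linarith)) _ _ (hnear y hy) (hnear z hz)
    rw [add_sub_add_left_eq_sub] at h2
    have h3 : ((S.F2star f t x1 x2 y - S.F2star f t x1 x2 z - Wop t' x' (y - z) : S.Y2star) : Y) =
        S.Q2star (f t (x1 + x2 + y) - f t (x1 + x2 + z) - f' t' x' ((y : D) - z)) := by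
      simp only [Submodule.coe_sub, hW t' x' hx, F2star, map_sub, map_add]
      abel
    calc ‖S.F2star f t x1 x2 y - S.F2star f t x1 x2 z - Wop t' x' (y - z)‖
        = ‖((S.F2star f t x1 x2 y - S.F2star f t x1 x2 z - Wop t' x' (y - z) : S.Y2star) : Y)‖ :=
          rfl
      _ ≤ q * ‖f t (x1 + x2 + y) - f t (x1 + x2 + z) - f' t' x' ((y : D) - z)‖ := by
          rw [h3]; exact ContinuousLinearMap.le_opNorm _ _
      _ ≤ q * (e * ‖(y : D) - z‖) := mul_le_mul_of_nonneg_left h2 hqnn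
      _ = q * e * ‖y - z‖ := by rw [mul_assoc]; rfl

theorem isLipschitzOnNonneg_of_local (h : S.LipschitzCondition f Wop ∨ S.SmoothCondition f Wop) :
    IsLipschitzOnNonneg f := by
  rcases h with h | h
  exacts [h.1, h.isLipschitzOnNonneg]

theorem isNearIso_of_local (h : S.LipschitzCondition f Wop ∨ S.SmoothCondition f Wop) {t' : ℝ}
    {x' : D} (hx : (t', x') ∈ S.L0 f) : S.IsNearIso f t' x' := by
  rcases h with h | h
  exacts [h.isNearIso hx, h.isNearIso hx]

/-- The extension of `f` to negative times by `f(0, ·)` is locally Lipschitz in `x`. -/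
theorem IsLipschitzOnNonneg.isLocallyLipschitz (h : IsLipschitzOnNonneg f) :
    IsLocallyLipschitz fun t x => f (max t 0) x := by
  intro t' x'
  obtain ⟨r, hr, L, hL, H⟩ := h (max t' 0) (le_max_right _ _) x'
  exact ⟨r, hr, L, hL, fun t ht => H _ (le_max_right _ _)
    (lt_of_le_of_lt (abs_max_sub_max_le_abs _ _ _) ht)⟩

theorem continuous_extend
    (hf : ContinuousOn (fun p : ℝ × D => f p.1 p.2) (Set.Ici 0 ×ˢ Set.univ)) :
    Continuous fun p : ℝ × D => f (max p.1 0) p.2 :=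
  hf.comp_continuous (f := fun p : ℝ × D => (max p.1 0, p.2))
    ((continuous_fst.max continuous_const).prodMk continuous_snd)
    fun _ => ⟨mem_Ici.2 (le_max_right _ _), mem_univ _⟩

/-! ### Regularity of the algebraic part -/

/-- The consistent point with algebraic part `d` and `A x = w`, as an operator. -/
def IsTame.point (hT : S.IsTame) : S.W × S.D20 →L[𝕜] D :=
  (hT.inv ∘L S.W.subtypeL).coprod S.D20.subtypeL

/-- The operator `B` at the point given by `w` and `d`. -/
def IsTame.pointB (hT : S.IsTame) : S.W × S.D20 →L[𝕜] Y :=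
  (hT.invB ∘L S.W.subtypeL).coprod hT.BKer

theorem IsTame.pointB_apply (hT : S.IsTame) (w : S.W) (d : S.D20) :
    hT.pointB (w, d) = B (hT.inv w + d) := by
  rw [map_add]; rfl

theorem continuous_residual (hT : S.IsTame)
    (hf : ContinuousOn (fun p : ℝ × D => f p.1 p.2) (Set.Ici 0 ×ˢ Set.univ)) :
    Continuous fun p : ℝ × S.W × S.D20 => residual hT f p.1 p.2.1 p.2.2 := by
  refine continuous_induced_rng.2 ?_
  have h : (fun p : ℝ × S.W × S.D20 => (residual hT f p.1 p.2.1 p.2.2 : Y)) = fun p =>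
      S.Q2star (f (max p.1 0) (hT.point p.2)) - S.Q2star (hT.pointB p.2) := by
    funext p
    exact coe_residual hT f _ _ _
  change Continuous (fun p : ℝ × S.W × S.D20 => (residual hT f p.1 p.2.1 p.2.2 : Y))
  rw [h]
  exact (S.Q2star.continuous.comp ((continuous_extend hf).comp
    (continuous_fst.prodMk (hT.point.continuous.comp continuous_snd)))).sub
    (S.Q2star.continuous.comp (hT.pointB.continuous.comp continuous_snd))

theorem isLocallyLipschitz_residual (hT : S.IsTame) (hL : IsLipschitzOnNonneg f) :
    IsLocallyLipschitz fun t (p : S.W × S.D20) => residual hT f t p.1 p.2 := by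
  have h : IsLocallyLipschitz fun t (p : S.W × S.D20) => (residual hT f t p.1 p.2 : Y) := by
    have heq : (fun t (p : S.W × S.D20) => (residual hT f t p.1 p.2 : Y)) = fun t p =>
        S.Q2star (f (max t 0) (hT.point p)) - (S.Q2star ∘L hT.pointB) p := by
      funext t p
      exact coe_residual hT f _ _ _
    rw [heq]
    refine IsLocallyLipschitz.sub ?_ (.of_lipschitzWith (S.Q2star ∘L hT.pointB).lipschitz)
    have h1 : IsLocallyLipschitz fun t (p : S.W × S.D20) => f (max t 0) (hT.point p) :=
      hL.isLocallyLipschitz.comp (.of_lipschitzWith hT.point.lipschitz)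
        (hT.point.continuous.comp continuous_snd)
    intro t' x'
    obtain ⟨r, hr, L, hL, H⟩ := h1 t' x'
    refine ⟨r, hr, ‖S.Q2star‖ * L, by positivity, fun t ht x y hx hy => ?_⟩
    rw [← map_sub, mul_assoc]
    exact (S.Q2star.le_opNorm _).trans
      (mul_le_mul_of_nonneg_left (H t ht x y hx hy) (norm_nonneg _))
  exact h

theorem continuous_P2Sigma_inv (hT : S.IsTame) : Continuous fun y : Y => S.P2Sigma (hT.inv y) := by
  simp only [P2Sigma_apply, ← hT.invB_apply]
  refine continuous_finsetSum _ fun i _ => continuous_finsetSum _ fun k _ => ?_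
  exact ((S.q i k).continuous.comp hT.invB.continuous).smul continuous_const

theorem continuous_P1_inv (hT : S.IsTame) : Continuous fun w : S.W => S.P1 (hT.inv w) := by
  simp only [P1_apply, hT.P20_inv, sub_zero]
  exact (hT.inv.continuous.comp continuous_subtype_val).sub
    ((continuous_P2Sigma_inv hT).comp continuous_subtype_val)

theorem isNearIsomorphism_residual (hT : S.IsTame) (h : S.UniqueAlgebraicPart f)
    (hloc : ∀ t' x', (t', x') ∈ S.L0 f → S.IsNearIso f t' x') (t' : ℝ) (w' : S.W) :
    IsNearIsomorphism 𝕜 (residual hT f) (algPart hT h) t' w' := by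
  obtain ⟨Λ, r, hr, c, hc, H⟩ := hloc _ _ ((mem_L0_iff hT h t' w' _).2 rfl)
  rw [P1_add, P2Sigma_add, P20_add (hT.P20_inv w')] at H
  obtain ⟨δ₁, hδ₁, H₁⟩ := Metric.continuousAt_iff.1
    ((continuous_P1_inv hT).continuousAt (x := w')) r hr
  obtain ⟨δ₂, hδ₂, H₂⟩ := Metric.continuousAt_iff.1
    (((continuous_P2Sigma_inv hT).comp continuous_subtype_val).continuousAt (x := w')) r hr
  refine ⟨Λ, min r (min δ₁ δ₂), lt_min hr (lt_min hδ₁ hδ₂), c, hc, fun t ht w hw y z hy hz => ?_⟩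
  simp only [lt_min_iff] at ht hw hy hz
  refine H (max t 0) (le_max_right _ _)
    (lt_of_le_of_lt (abs_max_sub_max_le_abs _ _ _) ht.1) _ (S.P1_mem _) ?_ _ (S.P2Sigma_mem _) ?_
    y z hy.1 hz.1
  · rw [← dist_eq_norm]
    exact H₁ (by rw [dist_eq_norm]; exact hw.2.1)
  · rw [← dist_eq_norm]
    exact H₂ (by rw [dist_eq_norm]; exact hw.2.2)

theorem continuous_algPart (hT : S.IsTame) (h : S.UniqueAlgebraicPart f)
    (hf : ContinuousOn (fun p : ℝ × D => f p.1 p.2) (Set.Ici 0 ×ˢ Set.univ))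
    (hloc : S.LipschitzCondition f Wop ∨ S.SmoothCondition f Wop) :
    Continuous fun p : ℝ × S.W => algPart hT h p.1 p.2 := by
  have := S.finiteDimensional_D20
  have : CompleteSpace S.D20 := FiniteDimensional.complete 𝕜 _
  exact continuous_of_unique_zero (𝕜 := 𝕜) (residual_eq_zero_iff hT h)
    (isNearIsomorphism_residual hT h fun _ _ => isNearIso_of_local hloc)
    (continuous_residual hT hf)

theorem isLocallyLipschitz_algPart (hT : S.IsTame) (h : S.UniqueAlgebraicPart f)
    (hf : ContinuousOn (fun p : ℝ × D => f p.1 p.2) (Set.Ici 0 ×ˢ Set.univ))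
    (hloc : S.LipschitzCondition f Wop ∨ S.SmoothCondition f Wop) :
    IsLocallyLipschitz (algPart hT h) := by
  have := S.finiteDimensional_D20
  have : CompleteSpace S.D20 := FiniteDimensional.complete 𝕜 _
  exact isLocallyLipschitz_of_unique_zero (𝕜 := 𝕜) (residual_eq_zero_iff hT h)
    (isNearIsomorphism_residual hT h fun _ _ => isNearIso_of_local hloc)
    (continuous_residual hT hf)
    (isLocallyLipschitz_residual hT (isLipschitzOnNonneg_of_local hloc))

/-! ### The reduced differential equation -/

/-- The consistent point `x = Ã⁻¹ w + η(t, w)` determined by `t` and `w = A x`. -/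
def state (hT : S.IsTame) (h : S.UniqueAlgebraicPart f) (t : ℝ) (w : S.W) : D :=
  hT.inv w + algPart hT h t w

/-- The right-hand side of the reduced equation `w' = (I - Q₂*)[f(t, x) - B x]` on `W`, where
`x = Ã⁻¹ w + η(t, w)`. -/
def field (hT : S.IsTame) (h : S.UniqueAlgebraicPart f) (t : ℝ) (w : S.W) : S.W :=
  ⟨(f (max t 0) (state hT h t w) - B (state hT h t w)) -
    S.Q2star (f (max t 0) (state hT h t w) - B (state hT h t w)), S.sub_Q2star_mem_W _⟩

theorem coe_field_eq (hT : S.IsTame) (h : S.UniqueAlgebraicPart f) {t : ℝ} (ht : 0 ≤ t)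
    (w : S.W) : (field hT h t w : Y) = (f t (state hT h t w) - B (state hT h t w)) -
      S.Q2star (f t (state hT h t w) - B (state hT h t w)) := by
  simp only [field, max_eq_left ht]

theorem state_mem_L0 (hT : S.IsTame) (h : S.UniqueAlgebraicPart f) {t : ℝ} (ht : 0 ≤ t)
    (w : S.W) : (t, state hT h t w) ∈ S.L0 f := by
  have := (mem_L0_iff hT h t w _).2 rfl
  rwa [max_eq_left ht] at this

theorem A_state (hT : S.IsTame) (h : S.UniqueAlgebraicPart f) (t : ℝ) (w : S.W) :
    A (state hT h t w) = w := by
  have h0 : A (algPart hT h t w) = 0 := (algPart hT h t w).2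
  rw [state, map_add, hT.A_inv, h0, add_zero]

/-- A consistent point is determined by `t` and `A x`. -/
theorem eq_state (hT : S.IsTame) (h : S.UniqueAlgebraicPart f) {t : ℝ} {x : D}
    (hx : (t, x) ∈ S.L0 f) : x = state hT h t ⟨A x, S.A_mem_W x⟩ := by
  have h1 : hT.inv (A x) + S.P20 x = x := by rw [hT.inv_A]; abel
  have h2 := (mem_L0_iff hT h t ⟨A x, S.A_mem_W x⟩ ⟨S.P20 x, S.P20_mem x⟩).1 (by
    rw [max_eq_left hx.1, h1]
    exact hx)
  rw [state, ← h2, h1]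

/-- On consistent points the projection `I - Q₂*` has no effect. -/
theorem coe_field (hT : S.IsTame) (h : S.UniqueAlgebraicPart f) {t : ℝ} (ht : 0 ≤ t) (w : S.W) :
    (field hT h t w : Y) = f t (state hT h t w) - B (state hT h t w) := by
  rw [coe_field_eq hT h ht, (state_mem_L0 hT h ht w).2, sub_zero]

theorem coe_field_eq_drift (hT : S.IsTame) (h : S.UniqueAlgebraicPart f) {t : ℝ} (ht : 0 ≤ t)
    (w : S.W) : (field hT h t w : Y) = S.Atilde (S.drift f t (state hT h t w)) := by
  rw [drift, hT.Atilde_AtildeInv, Q1_add_Q2Sigma, coe_field_eq hT h ht]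

theorem continuous_state (hT : S.IsTame) (h : S.UniqueAlgebraicPart f)
    (hf : ContinuousOn (fun p : ℝ × D => f p.1 p.2) (Set.Ici 0 ×ˢ Set.univ))
    (hloc : S.LipschitzCondition f Wop ∨ S.SmoothCondition f Wop) :
    Continuous fun p : ℝ × S.W => state hT h p.1 p.2 :=
  hT.point.continuous.comp (continuous_snd.prodMk (continuous_algPart hT h hf hloc))

theorem continuous_field (hT : S.IsTame) (h : S.UniqueAlgebraicPart f)
    (hf : ContinuousOn (fun p : ℝ × D => f p.1 p.2) (Set.Ici 0 ×ˢ Set.univ))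
    (hloc : S.LipschitzCondition f Wop ∨ S.SmoothCondition f Wop) :
    Continuous fun p : ℝ × S.W => field hT h p.1 p.2 := by
  have h1 : Continuous fun p : ℝ × S.W => f (max p.1 0) (state hT h p.1 p.2) :=
    (continuous_extend hf).comp (continuous_fst.prodMk (continuous_state hT h hf hloc))
  have h2 : Continuous fun p : ℝ × S.W => B (state hT h p.1 p.2) := by
    have : (fun p : ℝ × S.W => B (state hT h p.1 p.2)) =
        fun p => hT.pointB (p.2, algPart hT h p.1 p.2) := by
      funext p
      rw [hT.pointB_apply, state]
    rw [this]
    exact hT.pointB.continuous.comp (continuous_snd.prodMk (continuous_algPart hT h hf hloc))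
  exact continuous_induced_rng.2
    ((h1.sub h2).sub (S.Q2star.continuous.comp (h1.sub h2)))

theorem isLocallyLipschitz_field (hT : S.IsTame) (h : S.UniqueAlgebraicPart f)
    (hf : ContinuousOn (fun p : ℝ × D => f p.1 p.2) (Set.Ici 0 ×ˢ Set.univ))
    (hloc : S.LipschitzCondition f Wop ∨ S.SmoothCondition f Wop) :
    IsLocallyLipschitz (field hT h) := by
  have hp : IsLocallyLipschitz fun t w => (w, algPart hT h t w) :=
    (isLocallyLipschitz_algPart hT h hf hloc).prodMk_right
  have hpc : Continuous fun p : ℝ × S.W => (p.2, algPart hT h p.1 p.2) :=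
    continuous_snd.prodMk (continuous_algPart hT h hf hloc)
  have hs : IsLocallyLipschitz (state hT h) :=
    IsLocallyLipschitz.comp (g := fun _ p => hT.point p)
      (.of_lipschitzWith hT.point.lipschitz) hp hpc
  have h1 : IsLocallyLipschitz fun t w => f (max t 0) (state hT h t w) :=
    (isLipschitzOnNonneg_of_local hloc).isLocallyLipschitz.comp hs (continuous_state hT h hf hloc)
  have h2 : IsLocallyLipschitz fun t w => B (state hT h t w) := by
    have : (fun t w => B (state hT h t w)) = fun t w => hT.pointB (w, algPart hT h t w) := by
      funext t w
      rw [hT.pointB_apply, state]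
    rw [this]
    exact IsLocallyLipschitz.comp (g := fun _ p => hT.pointB p)
      (.of_lipschitzWith hT.pointB.lipschitz) hp hpc
  have h3 := h1.sub h2
  have h4 : IsLocallyLipschitz fun t w => ((field hT h t w : S.W) : Y) := by
    intro t' w'
    obtain ⟨r, hr, L, hL, H⟩ := h3 t' w'
    refine ⟨r, hr, L + ‖S.Q2star‖ * L, by positivity, fun t ht x y hx hy => ?_⟩
    have h5 := H t ht x y hx hy
    beta_reduce at h5
    simp only [field]
    generalize f (max t 0) (state hT h t x) - B (state hT h t x) = p at h5 ⊢
    generalize f (max t 0) (state hT h t y) - B (state hT h t y) = q at h5 ⊢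
    calc ‖p - S.Q2star p - (q - S.Q2star q)‖ = ‖(p - q) - S.Q2star (p - q)‖ := by
          rw [map_sub]; congr 1; abel
      _ ≤ ‖p - q‖ + ‖S.Q2star (p - q)‖ := norm_sub_le _ _
      _ ≤ ‖p - q‖ + ‖S.Q2star‖ * ‖p - q‖ := by gcongr; exact S.Q2star.le_opNorm _
      _ ≤ L * ‖x - y‖ + ‖S.Q2star‖ * (L * ‖x - y‖) := by gcongr
      _ = _ := by ring
  exact h4

/-- On bounded sets the algebraic part is bounded, because `F₂*` vanishes on `L₀`, and hence so is
the right-hand side of the reduced equation. -/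
theorem exists_bound_field (hT : S.IsTame) (h : S.UniqueAlgebraicPart f)
    (hb : S.BoundednessCondition f Wop) (T ρ : ℝ) :
    ∃ C : ℝ, ∀ t, 0 ≤ t → t ≤ T → ∀ w : S.W, ‖w‖ ≤ ρ → ‖field hT h t w‖ ≤ C := by
  obtain ⟨K, -, hK, C, hC⟩ := hb (max T 1) (‖hT.inv‖ * |ρ| + 1) (by positivity) (by positivity)
  set b : ℝ := ‖hT.invB‖ * |ρ| + ‖hT.BKer‖ * K with hbdef
  refine ⟨C + (b + ‖S.Q2star‖ * b), fun t ht htT w hw => ?_⟩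
  have hwρ : ‖(w : Y)‖ ≤ |ρ| := hw.trans (le_abs_self ρ)
  set x := state hT h t w with hx
  have hxL : (t, x) ∈ S.L0 f := state_mem_L0 hT h ht w
  have hP1 : S.P1 x = S.P1 (hT.inv w) := P1_add _ _
  have hP2 : S.P2Sigma x = S.P2Sigma (hT.inv w) := P2Sigma_add _ _
  have hP20 : S.P20 x = algPart hT h t w := P20_add (hT.P20_inv w) _
  have hsum : ‖S.P1 x + S.P2Sigma x‖ ≤ ‖hT.inv‖ * |ρ| + 1 := by
    rw [hP1, hP2, P1_add_P2Sigma (hT.P20_inv w)]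
    have := (hT.inv.le_opNorm w).trans (mul_le_mul_of_nonneg_left hwρ (norm_nonneg _))
    linarith
  have htT' : t ≤ max T 1 := htT.trans (le_max_left _ _)
  have hFzero : S.F2star f t (S.P1 x) (S.P2Sigma x) (S.P20 x) = 0 := by
    refine Subtype.ext ?_
    rw [hP1, hP2, hP20, coe_F2star (hT.P20_inv w)]
    exact hxL.2
  have hK' := hK t x hxL htT' hsum
  rw [hFzero, map_zero, ZeroMemClass.coe_zero, sub_zero] at hK'
  have hC' := hC t x hxL htT' hsum hK'
  rw [Q1_add_Q2Sigma] at hC'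
  have hBx : ‖B x‖ ≤ b := by
    have h1 : B x = hT.invB w + hT.BKer (algPart hT h t w) := by
      rw [hx, state, map_add]; rfl
    rw [h1]
    have h2 := (hT.invB.le_opNorm w).trans (mul_le_mul_of_nonneg_left hwρ (norm_nonneg _))
    have h3 : ‖algPart hT h t w‖ ≤ K := by rw [hP20] at hK'; exact hK'
    have h4 := (hT.BKer.le_opNorm (algPart hT h t w)).trans
      (mul_le_mul_of_nonneg_left h3 (norm_nonneg _))
    exact (norm_add_le _ _).trans (add_le_add h2 h4)
  have hfield : (field hT h t w : Y) = (f t x - S.Q2star (f t x)) - (B x - S.Q2star (B x)) := by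
    rw [coe_field_eq hT h ht, ← hx, map_sub]
    abel
  calc ‖field hT h t w‖ = ‖(field hT h t w : Y)‖ := rfl
    _ ≤ ‖f t x - S.Q2star (f t x)‖ + ‖B x - S.Q2star (B x)‖ := by
        rw [hfield]; exact norm_sub_le _ _
    _ ≤ C + (‖B x‖ + ‖S.Q2star (B x)‖) := add_le_add hC' (norm_sub_le _ _)
    _ ≤ C + (b + ‖S.Q2star‖ * b) := by
        gcongr
        exact (S.Q2star.le_opNorm _).trans (mul_le_mul_of_nonneg_left hBx (norm_nonneg _))

end CanonicalSystem

/-! ### Differentiation of curves -/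

section Curves

variable {E : Type*} [NormedAddCommGroup E] [NormedSpace ℝ E]

theorem contDiffOn_one_of_hasDerivWithinAt {g g' : ℝ → E} {s : Set ℝ} (hs : UniqueDiffOn ℝ s)
    (hg : ∀ t ∈ s, HasDerivWithinAt g (g' t) s t) (hg' : ContinuousOn g' s) :
    ContDiffOn ℝ 1 g s := by
  rw [contDiffOn_one_iff_derivWithin hs]
  exact ⟨fun t ht => (hg t ht).differentiableWithinAt,
    hg'.congr fun t ht => (hg t ht).derivWithin (hs t ht)⟩

/-- A curve whose derivative grows at most linearly with its norm has a limit at the left end point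
of a bounded interval. -/
theorem exists_tendsto_nhdsGT_of_linear_growth [CompleteSpace E] {g g' : ℝ → E} {a b K C : ℝ}
    (hab : a < b) (hK : 0 ≤ K) (hC : 0 ≤ C) (hg : ∀ t ∈ Ioo a b, HasDerivAt g (g' t) t)
    (hbound : ∀ t ∈ Ioo a b, ‖g' t‖ ≤ C * ‖g t‖ + K) : ∃ l, Tendsto g (𝓝[>] a) (𝓝 l) := by
  obtain ⟨c, hac, hcb⟩ := exists_between hab
  -- Gronwall's inequality for the time-reversed curve bounds `g` on `(a, c]`
  set M : ℝ := gronwallBound ‖g c‖ C K (c - a) with hM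
  have hgM : ∀ t ∈ Ioo a c, ‖g t‖ ≤ M := by
    intro t ht
    have hmem : ∀ τ ∈ Icc (-c) (-t), -τ ∈ Ioo a b := fun τ hτ =>
      ⟨by linarith [hτ.2, ht.1], by linarith [hτ.1]⟩
    have hder : ∀ τ ∈ Icc (-c) (-t), HasDerivAt (fun τ => g (-τ)) (-g' (-τ)) τ := fun τ hτ => by
      simpa [Function.comp_def] using (hg (-τ) (hmem τ hτ)).scomp τ (hasDerivAt_neg τ)
    have h1 := norm_le_gronwallBound_of_norm_deriv_right_le (f := fun τ => g (-τ))
      (f' := fun τ => -g' (-τ)) (δ := ‖g c‖) (K := C) (ε := K) (a := -c) (b := -t)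
      (fun τ hτ => (hder τ hτ).continuousAt.continuousWithinAt)
      (fun τ hτ => (hder τ (Ico_subset_Icc_self hτ)).hasDerivWithinAt) (by simp)
      (fun τ hτ => by
        rw [norm_neg]
        exact hbound _ (hmem τ (Ico_subset_Icc_self hτ)))
      (-t) ⟨by linarith [ht.2], le_rfl⟩
    rw [neg_neg] at h1
    exact h1.trans (gronwallBound_mono (norm_nonneg _) hK hC (by linarith [ht.1]))
  have hLip : LipschitzOnWith (C * M + K).toNNReal g (Ioo a c) := by
    refine (convex_Ioo a c).lipschitzOnWith_of_nnnorm_hasDerivWithin_le (f' := g')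
      (fun t ht => (hg t ⟨ht.1, ht.2.trans hcb⟩).hasDerivWithinAt) fun t ht => ?_
    refine NNReal.coe_le_coe.1 (le_trans ?_ (Real.le_coe_toNNReal _))
    exact (hbound t ⟨ht.1, ht.2.trans hcb⟩).trans
      (by gcongr; exact hgM t ht)
  exact cauchy_map_iff_exists_tendsto.1 (((cauchy_nhds (a := a)).mono nhdsWithin_le_nhds).map_of_le
    hLip.uniformContinuousOn (le_principal_iff.2 (Ioo_mem_nhdsGT hac)))

end Curves

namespace CanonicalSystem

variable {𝕜 D Y : Type*} [RCLike 𝕜] [NormedAddCommGroup D] [NormedSpace 𝕜 D]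
  [NormedAddCommGroup Y] [NormedSpace 𝕜 Y] [NormedSpace ℝ Y]
  [IsScalarTower ℝ 𝕜 Y] {A B : D →ₗ[𝕜] Y} {ν n : ℕ}
  {S : CanonicalSystem A B ν n} {f : ℝ → D → Y} {Wop : ℝ → D → (S.D20 ≃L[𝕜] S.Y2star)}

theorem hasDerivAt_coe_iff {w : ℝ → S.W} {v : S.W} {t : ℝ} :
    HasDerivAt (fun s => (w s : Y)) (v : Y) t ↔ HasDerivAt w v t := by
  rw [hasDerivAt_iff_isLittleO, hasDerivAt_iff_isLittleO, ← Asymptotics.isLittleO_norm_left,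
    ← Asymptotics.isLittleO_norm_left (f' := fun x' => w x' - w t - (x' - t) • v)]
  rfl

theorem hasDerivWithinAt_coe {w : ℝ → S.W} {v : S.W} {s : Set ℝ} {t : ℝ}
    (h : HasDerivWithinAt w v s t) : HasDerivWithinAt (fun s => (w s : Y)) (v : Y) s t := by
  rw [hasDerivWithinAt_iff_isLittleO, ← Asymptotics.isLittleO_norm_left] at h ⊢
  exact h

/-! ### Global existence for the reduced equation -/

/-- The Lyapunov condition excludes that a solution of the reduced equation blows up. -/
theorem LyapunovCondition.not_tendsto_norm_atTop (hT : S.IsTame) (h : S.UniqueAlgebraicPart f)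
    (hG : Continuous fun p : ℝ × S.W => field hT h p.1 p.2) [CompleteSpace Y]
    {N : ℕ} {R : ℝ} {V : Fin N → S.W → ℝ} {j : S.W → Fin N} {U ψ : ℝ → ℝ}
    (hV : S.LyapunovCondition f R V j U ψ) {t₀ T : ℝ} (ht₀ : 0 ≤ t₀) (hT₀ : t₀ < T)
    {w : ℝ → S.W} (hw : ∀ b < T, IsRightSolution (field hT h) w t₀ b) :
    ¬ Tendsto (fun t => ‖w t‖) (𝓝[<] T) atTop := by
  intro hinf
  have := S.completeSpace_W
  -- close to `T` the solution stays in the open set `{‖w‖ > R}`, where relative and full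
  -- derivatives of the `V_i` agree
  obtain ⟨a, haT, haR⟩ := (mem_nhdsLT_iff_exists_Ioo_subset' hT₀).1
    ((hinf.eventually_gt_atTop R).and (Ioo_mem_nhdsLT hT₀))
  have hO : IsOpen {w : S.W | R < ‖w‖} := isOpen_lt continuous_const continuous_norm
  have hOsub : {w : S.W | R < ‖w‖} ⊆ {w : S.W | R ≤ ‖w‖} := fun w (hw : R < ‖w‖) => hw.le
  have hd : ∀ t ∈ Ioo a T, HasDerivAt w (field hT h t (w t)) t := fun t ht => by
    obtain ⟨b, htb, hbT⟩ := exists_between ht.2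
    exact (hw b hbT).hasDerivAt hG ⟨(haR ht).2.1, htb⟩
  have hwc : ContinuousOn w (Ioo a T) := fun t ht => (hd t ht).continuousAt.continuousWithinAt
  have hw1 : ContDiffOn ℝ 1 w (Ioo a T) :=
    contDiffOn_one_of_hasDerivWithinAt isOpen_Ioo.uniqueDiffOn
      (fun t ht => (hd t ht).hasDerivWithinAt) (hG.comp_continuousOn (continuousOn_id.prodMk hwc))
  have hmaps : MapsTo w (Ioo a T) {w : S.W | R < ‖w‖} := fun t ht => (haR ht).1
  have : Nonempty (Fin N) := ⟨j 0⟩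
  have hsup : ∀ w, V (j w) w = ⨆ i, V i w := fun w =>
    le_antisymm (le_ciSup (f := fun i => V i w) (Set.finite_range _).bddAbove (j w))
      (ciSup_le fun i => hV.j_max w i)
  have hpos : ∀ t ∈ Ioo a T, 0 ≤ t := fun t ht => ht₀.trans (haR ht).2.1.le
  refine not_tendsto_max_atTop (u := fun i t => V i (w t)) (j := fun t => j (w t)) haT
    (fun i => ((hV.V_contDiffOn i).mono hOsub).comp hw1 hmaps) (fun i t => hV.V_nonneg i _)
    (fun t i => hV.j_max _ i) hV.U_continuousOn hV.U_nonneg hV.integral_inv_U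
    (fun t ht => hV.ψ_nonneg t (hpos t ht)) ?_ ?_ ?_
  · refine (hV.ψ_integrableOn T (ht₀.trans hT₀.le)).mono_set fun t ht => ⟨hpos t ht, ht.2.le⟩
  · intro t ht
    have hmem : {w : S.W | R ≤ ‖w‖} ∈ 𝓝 (w t) := mem_of_superset (hO.mem_nhds (hmaps ht)) hOsub
    have hVd : DifferentiableAt ℝ (V (j (w t))) (w t) :=
      ((hV.V_contDiffOn (j (w t))).differentiableOn one_ne_zero).differentiableAt hmem
    have h1 : deriv (fun s => V (j (w t)) (w s)) t =
        fderiv ℝ (V (j (w t))) (w t) (field hT h t (w t)) :=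
      (hVd.hasFDerivAt.comp_hasDerivAt t (hd t ht)).deriv
    rw [h1, ← fderivWithin_of_mem_nhds hmem, hsup]
    exact hV.inequality t (w t) _ (algPart hT h t (w t)).2 (state_mem_L0 hT h (hpos t ht) _)
      (hOsub (hmaps ht)) _ (coe_field_eq_drift hT h (hpos t ht) _)
  · have h1 := hV.V_tendsto.comp (tendsto_norm_atTop_iff_cobounded.1 hinf)
    refine h1.congr fun t => ?_
    simp only [Function.comp_apply, hsup]

theorem exists_global_solution_field [CompleteSpace Y] (hT : S.IsTame)
    (h : S.UniqueAlgebraicPart f)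
    (hf : ContinuousOn (fun p : ℝ × D => f p.1 p.2) (Set.Ici 0 ×ˢ Set.univ))
    (hloc : S.LipschitzCondition f Wop ∨ S.SmoothCondition f Wop)
    (hb : S.BoundednessCondition f Wop)
    {N : ℕ} {R : ℝ} {V : Fin N → S.W → ℝ} {j : S.W → Fin N} {U ψ : ℝ → ℝ}
    (hV : S.LyapunovCondition f R V j U ψ) {t₀ : ℝ} (ht₀ : 0 ≤ t₀) (w₀ : S.W) :
    ∃ w : ℝ → S.W, w t₀ = w₀ ∧ ∀ b, IsRightSolution (field hT h) w t₀ b := by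
  have := S.completeSpace_W
  have hG := continuous_field hT h hf hloc
  refine exists_global_isRightSolution hG (isLocallyLipschitz_field hT h hf hloc) t₀ w₀
    fun T hT₀ w hw => ?_
  refine (tendsto_or_norm_tendsto_atTop hT₀ (fun ρ => ?_) hw).resolve_right
    (hV.not_tendsto_norm_atTop hT h hG ht₀ hT₀ hw)
  obtain ⟨C, hC⟩ := exists_bound_field hT h hb T ρ
  exact ⟨C, fun t ht x hx => hC t (ht₀.trans ht.1) ht.2.le x hx⟩

/-- A global solution of the reduced equation yields one of the original equation. -/
theorem isSolutionOn_state [CompleteSpace Y] (hT : S.IsTame) (h : S.UniqueAlgebraicPart f)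
    (hf : ContinuousOn (fun p : ℝ × D => f p.1 p.2) (Set.Ici 0 ×ˢ Set.univ))
    (hloc : S.LipschitzCondition f Wop ∨ S.SmoothCondition f Wop) {t₀ : ℝ} (ht₀ : 0 ≤ t₀)
    {w : ℝ → S.W} (hw : ∀ b, IsRightSolution (field hT h) w t₀ b) :
    IsSolutionOn A B f (Ici t₀) fun t => state hT h t (w t) := by
  have := S.completeSpace_W
  have hG := continuous_field hT h hf hloc
  have hd : ∀ t ∈ Ici t₀, HasDerivWithinAt w (field hT h t (w t)) (Ici t₀) t := by
    intro t ht
    rcases eq_or_lt_of_le (mem_Ici.1 ht) with rfl | hlt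
    · exact (hw (t₀ + 1)).hasDerivWithinAt t₀ ⟨le_rfl, by linarith⟩
    · exact ((hw (t + 1)).hasDerivAt hG ⟨hlt, by linarith⟩).hasDerivWithinAt
  have hwc : ContinuousOn w (Ici t₀) := fun t ht => (hd t ht).continuousWithinAt
  have hAd : ∀ t ∈ Ici t₀, HasDerivWithinAt (fun s => A (state hT h s (w s)))
      (field hT h t (w t) : Y) (Ici t₀) t := by
    simp only [A_state]
    exact fun t ht => hasDerivWithinAt_coe (hd t ht)
  refine ⟨(continuous_state hT h hf hloc).comp_continuousOn (continuousOn_id.prodMk hwc), ?_, ?_⟩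
  · refine contDiffOn_one_of_hasDerivWithinAt ((uniqueDiffOn_Ici t₀).inter isOpen_Ioi)
      (fun t ht => (hAd t ht.1).mono inter_subset_left) ?_
    exact continuous_subtype_val.comp_continuousOn
      (hG.comp_continuousOn (continuousOn_id.prodMk (hwc.mono inter_subset_left)))
  · intro t ht _
    rw [(hAd t ht).derivWithin (uniqueDiffOn_Ici t₀ t ht), coe_field hT h (ht₀.trans ht),
      sub_add_cancel]

/-! ### Solutions of the original equation solve the reduced one -/

/-- Applying `Q₂*` to the equation shows that a solution takes consistent values. -/
theorem mem_L0_of_isSolutionOn {J : Set ℝ} {y : ℝ → D} (hy : IsSolutionOn A B f J y) {t : ℝ}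
    (htJ : t ∈ J) (ht : 0 < t) (hu : UniqueDiffWithinAt ℝ J t) : (t, y t) ∈ S.L0 f := by
  refine ⟨ht.le, ?_⟩
  have hnhds : J ∩ Ioi 0 ∈ 𝓝[J] t :=
    inter_mem self_mem_nhdsWithin (mem_nhdsWithin_of_mem_nhds (Ioi_mem_nhds ht))
  have h1 : HasDerivWithinAt (fun s => A (y s)) (derivWithin (fun s => A (y s)) J t) J t :=
    ((hy.contDiffOn.differentiableOn one_ne_zero t ⟨htJ, ht⟩).mono_of_mem_nhdsWithin
      hnhds).hasDerivWithinAt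
  have h2 : HasDerivWithinAt (fun s => S.Q2star (A (y s)))
      (S.Q2star (derivWithin (fun s => A (y s)) J t)) J t :=
    (S.Q2star.restrictScalars ℝ).hasFDerivAt.comp_hasDerivWithinAt t h1
  simp only [S.Q2star_A] at h2
  have h3 := hu.eq_deriv _ h2 (hasDerivWithinAt_const t J (0 : Y))
  rwa [eq_sub_of_add_eq (hy.equation t htJ ht)] at h3

/-- If `y` solves the original equation on `[a, b]` and starts at a consistent point, then `A y`
solves the reduced equation. For `a = 0` the notion of a solution does not include the continuity of
`A y` at `a`; it follows from the linear growth of the equation in `A y` and the closedness of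
`A`. -/
theorem isRightSolution_A [CompleteSpace Y] (hT : S.IsTame) (h : S.UniqueAlgebraicPart f)
    (hf : ContinuousOn (fun p : ℝ × D => f p.1 p.2) (Set.Ici 0 ×ˢ Set.univ))
    (hloc : S.LipschitzCondition f Wop ∨ S.SmoothCondition f Wop) {J : Set ℝ} {y : ℝ → D}
    (hy : IsSolutionOn A B f J y) {a b : ℝ} (ha : 0 ≤ a) (hab : a < b) (hJ : Icc a b ⊆ J)
    (hL : ∀ t ∈ Icc a b, (t, y t) ∈ S.L0 f) :
    IsRightSolution (field hT h) (fun t => ⟨A (y t), S.A_mem_W (y t)⟩) a b := by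
  set w : ℝ → S.W := fun t => ⟨A (y t), S.A_mem_W (y t)⟩ with hw
  have hG := continuous_field hT h hf hloc
  have hyc : ContinuousOn y (Icc a b) := hy.continuousOn.mono hJ
  have hAc : ContinuousOn (fun t => A (y t)) (Ioc a b) :=
    hy.contDiffOn.continuousOn.mono fun t ht => ⟨hJ ⟨ht.1.le, ht.2⟩, ha.trans_lt ht.1⟩
  have hAd : ∀ t ∈ Ioo a b, HasDerivAt (fun s => A (y s)) (f t (y t) - B (y t)) t := by
    intro t ht
    have htJ : J ∈ 𝓝 t := mem_of_superset (Icc_mem_nhds ht.1 ht.2) hJ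
    have ht0 : 0 < t := ha.trans_lt ht.1
    have h1 : DifferentiableAt ℝ (fun s => A (y s)) t :=
      (hy.contDiffOn.differentiableOn one_ne_zero).differentiableAt
        (inter_mem htJ (Ioi_mem_nhds ht0))
    have h2 := eq_sub_of_add_eq (hy.equation t (mem_of_mem_nhds htJ) ht0)
    rw [derivWithin_of_mem_nhds htJ] at h2
    rw [← h2]
    exact h1.hasDerivAt
  have hwd : ∀ t ∈ Ioo a b, HasDerivAt w (field hT h t (w t)) t := by
    intro t ht
    rw [← hasDerivAt_coe_iff, coe_field hT h (ha.trans ht.1.le),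
      ← eq_state hT h (hL t (Ioo_subset_Icc_self ht))]
    exact hAd t ht
  have hlim : Tendsto (fun t => A (y t)) (𝓝[>] a) (𝓝 (A (y a))) := by
    obtain ⟨C, hC, hCB⟩ := hT.exists_bound_B
    obtain ⟨K₁, hK₁⟩ := isCompact_Icc.exists_bound_of_continuousOn hyc
    obtain ⟨K₂, hK₂⟩ := isCompact_Icc.exists_bound_of_continuousOn
      (hf.comp (continuousOn_id.prodMk hyc) fun t (ht : t ∈ Icc a b) =>
        ⟨mem_Ici.2 (ha.trans ht.1), mem_univ _⟩)
    have hK₁0 : 0 ≤ K₁ := (norm_nonneg _).trans (hK₁ a (left_mem_Icc.2 hab.le))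
    have hK₂0 : 0 ≤ K₂ := (norm_nonneg _).trans (hK₂ a (left_mem_Icc.2 hab.le))
    obtain ⟨l, hl⟩ := exists_tendsto_nhdsGT_of_linear_growth (K := K₂ + C * K₁) (C := C) hab
      (by positivity) hC hAd fun t ht => by
        have h1 := hK₁ t (Ioo_subset_Icc_self ht)
        have h2 : ‖f t (y t)‖ ≤ K₂ := hK₂ t (Ioo_subset_Icc_self ht)
        have h3 := (hCB (y t)).trans
          (mul_le_mul_of_nonneg_left (add_le_add_left h1 ‖A (y t)‖) hC)
        refine (norm_sub_le _ _).trans ?_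
        linarith
    have hya : Tendsto y (𝓝[>] a) (𝓝 (y a)) :=
      (hyc a (left_mem_Icc.2 hab.le)).mono_of_mem_nhdsWithin
        (mem_of_superset (Ioo_mem_nhdsGT hab) Ioo_subset_Icc_self)
    rw [hT.closed _ y (y a) l hya hl]
    exact hl
  have hAc' : ContinuousOn (fun t => A (y t)) (Icc a b) := by
    intro t ht
    rcases eq_or_lt_of_le ht.1 with rfl | hlt
    · have h1 : ContinuousWithinAt (fun t => A (y t)) (Ici a) a :=
        continuousWithinAt_Ioi_iff_Ici.1 hlim
      exact h1.mono Icc_subset_Ici_self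
    · refine (hAc t ⟨hlt, ht.2⟩).mono_of_mem_nhdsWithin ?_
      filter_upwards [self_mem_nhdsWithin, mem_nhdsWithin_of_mem_nhds (Ioi_mem_nhds hlt)]
        with s hs hs' using ⟨hs', hs.2⟩
  have hwc : ContinuousOn w (Icc a b) := by
    rw [IsInducing.subtypeVal.continuousOn_iff]
    exact hAc'
  refine ⟨hwc, fun t ht => ?_⟩
  -- at the initial time the right derivative is the limit of the derivatives
  rcases eq_or_lt_of_le ht.1 with rfl | hlt
  · have hIoo : Ioo a b ∈ 𝓝[>] a := Ioo_mem_nhdsGT hab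
    have hwa : ContinuousWithinAt w (Ioo a b) a :=
      (hwc a (left_mem_Icc.2 hab.le)).mono Ioo_subset_Icc_self
    refine hasDerivWithinAt_Ici_of_tendsto_deriv
      (fun t ht => (hwd t ht).differentiableAt.differentiableWithinAt) hwa hIoo ?_
    have h1 : ContinuousWithinAt (fun t => field hT h t (w t)) (Ioo a b) a :=
      hG.continuousAt.comp_continuousWithinAt (continuousWithinAt_id.prodMk hwa)
    have h2 : Tendsto (fun t => field hT h t (w t)) (𝓝[>] a) (𝓝 (field hT h a (w a))) :=
      h1.mono_of_mem_nhdsWithin hIoo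
    refine h2.congr' ?_
    filter_upwards [hIoo] with t ht using (hwd t ht).deriv.symm
  · exact (hwd t ⟨hlt, ht.2⟩).hasDerivWithinAt

end CanonicalSystem

end ADAE

end

theorem mainTheorem2
    {𝕜 X Y : Type*} [RCLike 𝕜]
    [NormedAddCommGroup X] [NormedSpace 𝕜 X] [CompleteSpace X]
    [NormedAddCommGroup Y] [NormedSpace 𝕜 Y] [CompleteSpace Y]
    [NormedSpace ℝ Y] [IsScalarTower ℝ 𝕜 Y]
    -- closed densely defined operators with `D = D_A ⊆ D_B` and `range A` closed
    (A B : X →ₗ.[𝕜] Y) (hA : A.IsClosed) (hB : B.IsClosed)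
    (hA_dense : Dense (A.domain : Set X)) (hB_dense : Dense (B.domain : Set X))
    (hA_range : IsClosed (LinearMap.range A.toFun : Set Y))
    (hAB : A.domain ≤ B.domain)
    -- `lam A + B` is a regular pencil of index `ν`, with a canonical system of root vectors
    -- (in particular `dim ker A = n`)
    (ν n : ℕ)
    (hν : ADAE.IsRegularPencilOfIndex A.toFun (ADAE.restrictTo B A.domain hAB) ν)
    (S : ADAE.CanonicalSystem A.toFun (ADAE.restrictTo B A.domain hAB) ν n)
    -- the right-hand side
    (f : ℝ → A.domain → Y)
    (hf : ContinuousOn (fun p : ℝ × A.domain => f p.1 p.2) (Set.Ici 0 ×ˢ Set.univ))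
    -- solvability of the algebraic part and the local conditions, with the operators `W_{t,x}`
    (h_alg : S.UniqueAlgebraicPart f)
    (Wop : ℝ → A.domain → (S.D20 ≃L[𝕜] S.Y2star))
    (h_loc : S.LipschitzCondition f Wop ∨ S.SmoothCondition f Wop)
    (h_bdd : S.BoundednessCondition f Wop)
    -- the Lyapunov-type condition
    (N : ℕ) (R : ℝ) (V : Fin N → S.W → ℝ) (j : S.W → Fin N) (U ψ : ℝ → ℝ)
    (h_lyap : S.LyapunovCondition f R V j U ψ)
    (t₀ : ℝ) (x₀ : A.domain) (h₀ : (t₀, x₀) ∈ S.L0 f) :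
    ∃ x : ℝ → A.domain,
      ADAE.IsSolutionOn A.toFun (ADAE.restrictTo B A.domain hAB) f (Set.Ici t₀) x ∧ x t₀ = x₀ ∧
      ∀ (J : Set ℝ) (y : ℝ → A.domain), J.OrdConnected → t₀ ∈ J → J ⊆ Set.Ici t₀ →
        ADAE.IsSolutionOn A.toFun (ADAE.restrictTo B A.domain hAB) f J y → y t₀ = x₀ →
        Set.EqOn y x J := by
  have hT : S.IsTame := ADAE.CanonicalSystem.isTame A B hA hB hA_range hAB ν n _ rfl hν S
  obtain ⟨w, hw0, hw⟩ := ADAE.CanonicalSystem.exists_global_solution_field hT h_alg hf h_loc h_bdd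
    h_lyap h₀.1 ⟨A.toFun x₀, S.A_mem_W x₀⟩
  have hx₀ : ADAE.CanonicalSystem.state hT h_alg t₀ (w t₀) = x₀ := by
    rw [hw0, ← ADAE.CanonicalSystem.eq_state hT h_alg h₀]
  refine ⟨fun t => ADAE.CanonicalSystem.state hT h_alg t (w t),
    ADAE.CanonicalSystem.isSolutionOn_state hT h_alg hf h_loc h₀.1 hw, hx₀, ?_⟩
  intro J y hJ htJ hJt hy hy0 t ht
  rcases eq_or_lt_of_le (mem_Ici.1 (hJt ht)) with rfl | hlt
  · exact hy0.trans hx₀.symm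
  have hsub : Icc t₀ t ⊆ J := hJ.out htJ ht
  have hL : ∀ s ∈ Icc t₀ t, (s, y s) ∈ S.L0 f := by
    intro s hs
    rcases eq_or_lt_of_le hs.1 with rfl | hs0
    · rw [hy0]
      exact h₀
    · exact ADAE.CanonicalSystem.mem_L0_of_isSolutionOn hy (hsub hs) (lt_of_le_of_lt h₀.1 hs0)
        ((uniqueDiffOn_Icc hlt s hs).mono hsub)
  have hsol := ADAE.CanonicalSystem.isRightSolution_A hT h_alg hf h_loc hy h₀.1 hlt hsub hL
  have heq := hsol.eqOn (ADAE.CanonicalSystem.isLocallyLipschitz_field hT h_alg hf h_loc) (hw t)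
    (Subtype.ext (by rw [hw0, hy0])) ⟨hlt.le, le_rfl⟩
  rw [ADAE.CanonicalSystem.eq_state hT h_alg (hL t ⟨hlt.le, le_rfl⟩)]
  exact congrArg _ heq
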